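/- **Notation.** Write $x^y=y^{-1}xy$. A subgroup $H$ of a group $G$ is *benign* in $G$ if there are a finitely presented group $K$, an embedding $G\hookrightarrow K$ and a finitely generated subgroup $L\le K$ with $G\cap L=H$. Let $\mathcal E$ be the set of functions $f:\mathbb Z\to\mathbb Z$ of finite support. For $\mathcal X\subseteq\mathcal E$ let $\rho\mathcal X$ be the set of all $f\in\mathcal E$ for which there is a $g\in\mathcal X$ with $f(i)=g(-i)$ for all $i\in\mathbb Z$. Let $F=\langle a,b,c\rangle$ be the free group of rank $3$, $b_i=b^{c^i}$, $b_f=\cdots b_{-1}^{f(-1)}b_0^{f(0)}b_1^{f(1)}\cdots$, $a_f=a^{b_f}$ and $A_{\mathcal X}=\langle a_f : f\in\mathcal X\rangle\le F$. "$y$ sends $x$ to $z$" denotes the relation $x^y=z$, and "$y$ fixes $x$" the relation $x^y=x$. Let $X_{\mathscr A}=\{a,b,c,t,t',u_1,u_2,d,e\}$ and let $R_{\mathscr A}$ be the following $20$ relations: $b^{t}=b$, $b^{t'}=b^{c^{-1}}$, $c^{t}=c^2$, $c^{t'}=c^2$; $u_1$ fixes $b^c,t,t'$; $u_2$ fixes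 $a,b,t,t'$; $d$ fixes $a^{u_1},b^{u_1},c^{u_1}$; $d$ sends $a^{u_2},b^{u_2},c^{u_2}$ to $a^{bu_2},b^{u_2},c^{bu_2}$; $e$ sends $a,b,c$ to $a,b^c,c$. Bars denote copies on new letters; $X_{\bar{\mathscr A}}$ and $R_{\bar{\mathscr A}}$ are the barred copies of $X_{\mathscr A}$ and $R_{\mathscr A}$. **Theorem.** Let $\mathcal X\subseteq\mathcal E$ and $\mathcal Y=\rho\mathcal X$. 1. If $A_{\mathcal X}$ is benign in $F$, then $A_{\mathcal Y}$ is benign in $F$. 2. Suppose that $K_{\mathcal X}=\langle X\mid R\rangle$ is a group given by a finite set of generators $X$ that contains the three letters $a,b,c$ (and no other letter of $X_{\mathscr A}$) and a finite list $R$ of relators, that $a,b,c$ freely generate a subgroup $F$ of $K_{\mathcal X}$, and that $L_{\mathcal X}\le K_{\mathcal X}$ is generated by a finite list $S$ of words in $X$ and satisfies $F\cap L_{\mathcal X}=A_{\mathcal X}$. Let $\bar X,\bar R,\bar S$ be the barred copies of $X,R,S$. Let $K_{\mathcal Y}$ be the group with generators $$X_{\mathscr A},\quad X_{\bar{\mathscr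 A}},\quad \bar X\setminus\{\bar a,\bar b,\bar c\},\quad v_1,v_2,w_1,w_2,w_3,w_4$$ and with the following defining relations: $R_{\mathscr A}$, $R_{\bar{\mathscr A}}$, $\bar R$; every generator in $X_{\mathscr A}$ commutes with every generator in $X_{\bar{\mathscr A}}$ and with every generator in $\bar X\setminus\{\bar a,\bar b,\bar c\}$; $v_1$ fixes $\bar a a,\ \bar d d,\ \bar e e^{-1}$; $v_2$ fixes each word of $\bar S$ and $a,d,e$; $w_1$ fixes $\bar a,\bar b,\bar c$; $w_2$ fixes $x^{v_1v_2}$ for each $x\in X_{\mathscr A}\cup X_{\bar{\mathscr A}}$; $w_3$ fixes $a,b,c$; $w_4$ fixes $x^{w_1}$ and $x^{w_2}$ for each $x\in\{a,b,c,\bar a,\bar b,\bar c\}$. Let $$L_{\mathcal Y}=\langle a,b,c,\bar a,\bar b,\bar c\rangle^{w_3w_4}\le K_{\mathcal Y}.$$ Then $a,b,c$ freely generate a subgroup $F$ of $K_{\mathcal Y}$, and $F\cap L_{\mathcal Y}=A_{\mathcal Y}$. 3. If, in 2, there are $m$ generators in $X$ (with $a,b,c$ included), $n$ relators in $R$ and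 $k$ words in $S$, then the presentation of $K_{\mathcal Y}$ has $m+21$ generators and $n+9m+k+136$ relations, and $L_{\mathcal Y}$ is given by $6$ generators. 4. Suppose, more generally, that $K_{\mathcal X}=\langle x_1,\dots,x_m\mid R\rangle$ with $R$ finite, that $F$ is embedded in $K_{\mathcal X}$ with $a,b,c$ given by words $w_a,w_b,w_c$ in $x_1,\dots,x_m$, and that $L_{\mathcal X}$ is generated by a finite list of words and $F\cap L_{\mathcal X}=A_{\mathcal X}$. Then the construction in 2, applied to the presentation $\langle a,b,c,x_1,\dots,x_m\mid R,\ a=w_a,\ b=w_b,\ c=w_c\rangle$ and to the same words generating $L_{\mathcal X}$, gives a group $K_{\mathcal Y}$ in which $a,b,c$ freely generate a subgroup $F$, and a subgroup $L_{\mathcal Y}$ of it with $F\cap L_{\mathcal Y}=A_{\mathcal Y}$. -/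

import Mathlib

namespace Higman

/-! ### Benign subgroups -/

/-- A subgroup `H` of `G` is benign in `G` if `G` embeds, by some `φ`, into a finitely presented
group `K` having a finitely generated subgroup `L` with `φ(G) ∩ L = φ(H)`. -/
def IsBenign {G : Type*} [Group G] (H : Subgroup G) : Prop :=
  ∃ (K : Type) (_ : Group K) (φ : G →* K) (L : Subgroup K),
    Group.IsFinitelyPresented K ∧ L.FG ∧ Function.Injective φ ∧ L.comap φ = H

/-! ### Integer functions of finite support, and the subgroups they define -/

/-- The three letters `a, b, c`. -/
inductive FLetter where
  | a | b | c
  deriving DecidableEq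

/-- The free group `⟨a, b, c⟩` of rank `3`. -/
abbrev F : Type := FreeGroup FLetter

/-- Finitely supported functions `ℤ → ℤ`. -/
abbrev E : Type := ℤ →₀ ℤ

/-- The reversing operation: the set of all `f` such that for some `g ∈ X` one has
`f i = g (-i)` for all `i`. -/
def rho (X : Set E) : Set E := {f | ∃ g ∈ X, ∀ i : ℤ, f i = g (-i)}

section Words

variable {G : Type*} [Group G]

/-- The conjugate `x ^ y = y⁻¹ x y`. -/
def cj (x y : G) : G := y⁻¹ * x * y

/-- The element whose vanishing is the relation `x = y`. -/
def eqn (x y : G) : G := x * y⁻¹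

/-- The relation "`y` sends `x` to `z`", that is `y⁻¹ x y = z`. -/
def sends (y x z : G) : G := eqn (cj x y) z

/-- The relation "`y` fixes `x`", that is `y⁻¹ x y = x`. -/
def fixes (y x : G) : G := sends y x x

/-- The relation "`x` and `y` commute". -/
def commutes (x y : G) : G := eqn (x * y) (y * x)

end Words

/-- `b_i = c⁻ⁱ b cⁱ` in `F`. -/
def bI (i : ℤ) : F := cj (FreeGroup.of FLetter.b) (FreeGroup.of FLetter.c ^ i)

/-- `b_f = ⋯ b₋₁ ^ f(-1) b₀ ^ f(0) b₁ ^ f(1) ⋯`, the factors taken in increasing order of index. -/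
def bF (f : E) : F := ((f.support.sort (· ≤ ·)).map fun i => bI i ^ f i).prod

/-- `a_f = b_f⁻¹ a b_f`. -/
def aF (f : E) : F := cj (FreeGroup.of FLetter.a) (bF f)

/-- `A_X`, the subgroup of `F` generated by all `a_f` with `f ∈ X`. -/
def subgroupA (X : Set E) : Subgroup F := Subgroup.closure (aF '' X)

/-! ### Explicitly given pairs `K`, `L` -/

/-- The group with generating set `β` and the listed words as defining relators. -/
abbrev Presented {β : Type} (R : List (FreeGroup β)) : Type := PresentedGroup {r | r ∈ R}

/-- The homomorphism from `F` to `⟨β | R⟩` sending `a, b, c` to the words `w`. -/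
def letterHom {β : Type} (R : List (FreeGroup β)) (w : FLetter → FreeGroup β) :
    F →* Presented R :=
  FreeGroup.lift fun x => PresentedGroup.mk _ (w x)

/-- The subgroup of `⟨β | R⟩` generated by the listed words. -/
def wordSubgroup {β : Type} (R S : List (FreeGroup β)) : Subgroup (Presented R) :=
  Subgroup.closure {x | ∃ s ∈ S, x = PresentedGroup.mk _ s}

/-- The group `K = ⟨β | R⟩`, in which `a, b, c` are written as the words `w`, and its subgroup `L`
generated by the words `S` are explicitly given groups for the subgroup `H` of `F`:
the map `F → K` is an embedding and `F ∩ L = H`. -/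
def IsExplicitPair {β : Type} (R S : List (FreeGroup β)) (w : FLetter → FreeGroup β)
    (H : Subgroup F) : Prop :=
  Function.Injective (letterHom R w) ∧ (wordSubgroup R S).comap (letterHom R w) = H

/-! ### The group `𝒜` -/

/-- The nine generators of `𝒜`; `t'` is written `s`. -/
inductive ALetter where
  | a | b | c | t | s | u₁ | u₂ | d | e
  deriving DecidableEq

/-- The letters of `F` among those of `𝒜`. -/
def FLetter.toA : FLetter → ALetter
  | .a => .a
  | .b => .b
  | .c => .c

/-- The list of the three letters of `F`. -/
def fLetters : List FLetter := [.a, .b, .c]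

/-- The list of the nine generators of `𝒜`. -/
def aLetters : List ALetter := [.a, .b, .c, .t, .s, .u₁, .u₂, .d, .e]

/-- The twenty defining relators of `𝒜`, written in elements `g x` of a group, one for each of the
nine generators `x`. -/
def relatorsA {G : Type*} [Group G] (g : ALetter → G) : List G :=
  let a := g .a
  let b := g .b
  let c := g .c
  let t := g .t
  let s := g .s
  let u₁ := g .u₁
  let u₂ := g .u₂
  let d := g .d
  let e := g .e
  [ sends t b b, sends s b (cj b c⁻¹), sends t c (c ^ 2), sends s c (c ^ 2),
    fixes u₁ (cj b c), fixes u₁ t, fixes u₁ s,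
    fixes u₂ a, fixes u₂ b, fixes u₂ t, fixes u₂ s,
    fixes d (cj a u₁), fixes d (cj b u₁), fixes d (cj c u₁),
    sends d (cj a u₂) (cj a (b * u₂)), sends d (cj b u₂) (cj b u₂),
    sends d (cj c u₂) (cj c (b * u₂)),
    sends e a a, sends e b (cj b c), sends e c c ]

/-! ### The groups `K` and `L` of the reversed set

The given group `K_X` has the generators `a, b, c` and `r` further ones, i.e. its generating set is
`FLetter ⊕ Fin r`. -/

/-- Generators: those of `𝒜`, those of the barred copy of `𝒜`, the barred copies of the `r` further
generators of `K_X`, and `v₁, v₂, w₁, w₂, w₃, w₄`. -/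
inductive KLetter (r : ℕ) where
  | plain (x : ALetter)
  | bar (x : ALetter)
  | extra (i : Fin r)
  | v₁ | v₂ | w₁ | w₂ | w₃ | w₄
  deriving DecidableEq

variable {r : ℕ}

/-- The barred copy of a generator of `K_X`. -/
def barLetter : FLetter ⊕ Fin r → KLetter r
  | .inl x => .bar x.toA
  | .inr i => .extra i

/-- The barred copy of a word in the generators of `K_X`. -/
def barWord : FreeGroup (FLetter ⊕ Fin r) →* FreeGroup (KLetter r) := FreeGroup.map barLetter

/-- A generator of `𝒜`. -/
def pl (x : ALetter) : FreeGroup (KLetter r) := .of (.plain x)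

/-- A generator of the barred copy of `𝒜`. -/
def br (x : ALetter) : FreeGroup (KLetter r) := .of (.bar x)

/-- The six words `a, b, c, ā, b̄, c̄`. -/
def sixWords : List (FreeGroup (KLetter r)) :=
  (fLetters.map fun x => pl x.toA) ++ (fLetters.map fun x => br x.toA)

/-- The defining relators of `K_{ρX}`, when `K_X = ⟨a, b, c, x₁, …, x_r | R⟩` and `L_X` is generated
by `S`. -/
def relatorsRho (R S : List (FreeGroup (FLetter ⊕ Fin r))) : List (FreeGroup (KLetter r)) :=
  let v₁ : FreeGroup (KLetter r) := .of .v₁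
  let v₂ : FreeGroup (KLetter r) := .of .v₂
  let w₁ : FreeGroup (KLetter r) := .of .w₁
  let w₂ : FreeGroup (KLetter r) := .of .w₂
  let w₃ : FreeGroup (KLetter r) := .of .w₃
  let w₄ : FreeGroup (KLetter r) := .of .w₄
  relatorsA pl ++ relatorsA br ++ R.map barWord
  ++ (aLetters.flatMap fun x => aLetters.map fun y => commutes (pl x) (br y))
  ++ (aLetters.flatMap fun x => (List.finRange r).map fun i => commutes (pl x) (.of (.extra i)))
  ++ [fixes v₁ (br .a * pl .a), fixes v₁ (br .d * pl .d), fixes v₁ (br .e * (pl .e)⁻¹)]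
  ++ (S.map fun s => fixes v₂ (barWord s))
  ++ [fixes v₂ (pl .a), fixes v₂ (pl .d), fixes v₂ (pl .e)]
  ++ [fixes w₁ (br .a), fixes w₁ (br .b), fixes w₁ (br .c)]
  ++ (aLetters.map fun x => fixes w₂ (cj (pl x) (v₁ * v₂)))
  ++ (aLetters.map fun x => fixes w₂ (cj (br x) (v₁ * v₂)))
  ++ [fixes w₃ (pl .a), fixes w₃ (pl .b), fixes w₃ (pl .c)]
  ++ (sixWords.map fun x => fixes w₄ (cj x w₁))
  ++ (sixWords.map fun x => fixes w₄ (cj x w₂))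

/-- The six generators of `L_{ρX} = ⟨a, b, c, ā, b̄, c̄⟩ ^ (w₃ w₄)`. -/
def generatorsRho : List (FreeGroup (KLetter r)) :=
  sixWords.map fun x => cj x (.of .w₃ * .of .w₄)

/-- The letters `a, b, c` in `K_{ρX}`. -/
def lettersRho (x : FLetter) : FreeGroup (KLetter r) := pl x.toA

/-! ### Adjoining the letters `a, b, c` to a presentation -/

/-- From a group `⟨x₁, …, x_m | R⟩` and words `w` for `a, b, c`: the relators obtained by adjoining
the new generators `a, b, c` and the three relations `a = w a`, `b = w b`, `c = w c`. -/
def adjoinRelators {m : ℕ} (R : List (FreeGroup (Fin m))) (w : FLetter → FreeGroup (Fin m)) :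
    List (FreeGroup (FLetter ⊕ Fin m)) :=
  R.map (FreeGroup.map Sum.inr)
  ++ fLetters.map fun x => eqn (.of (.inl x)) (FreeGroup.map Sum.inr (w x))

/-- The given words, read in the enlarged set of generators. -/
def adjoinWords {m : ℕ} (S : List (FreeGroup (Fin m))) : List (FreeGroup (FLetter ⊕ Fin m)) :=
  S.map (FreeGroup.map Sum.inr)

end Higman

/-! Conjugation by `d` takes `a_f` to `a_{f+δ₀}`, and conjugation by `e` takes it to `a_{f(·-1)}`.
Reversal turns a right shift into a left one. So in the product of 𝒜 with its barred copy,
conjugating `āa` by `d̄d` and `ēe⁻¹` and their inverses reaches every product of `ā_f` and `a_{ρf}`.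
The letter `v₁` records this graph of the reversal, `v₂` restricts it to `f ∈ X`, and the `w`'s
project it to the unbarred factor.

That `A_{ρX}` lies in `L_{ρX}` follows from the relations alone (`aF_mem`). For `g ∈ X` both `v₁`
and `v₂` fix `ā_g a_{ρg}`, so `w₂` fixes it. Then `w₄` fixes `ā_g` (through `w₁`) and `ā_g a_{ρg}`
(through `w₂`), hence `a_{ρg}`, which `w₃` fixes as well. So `a_{ρg}` is its own conjugate by
`w₃w₄`.

For the converse and for freeness, one group suffices in which the relations hold and the
intersection is no larger (`exists_rho_model`). It is built by adjoining elements that centralize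
prescribed subgroups, with control of what else they do (`exists_centralizing`,
`exists_centralizing_pair`). Its core is a model of 𝒜 (`exists_base`, `exists_model`) made of
permutations of a group: `F` acts by left multiplication, `d` and `e` fix `1`, and evaluation at `1`
recovers elements of `F`. Since the `a_f` are free generators (`freeA_injective`), reversal acts on
words in them. -/

namespace Higman

/-! ### Conjugation and the subgroups it fixes -/

section Conjugation

variable {G H : Type*} [Group G] [Group H]

theorem eqn_eq_one {x y : G} : eqn x y = 1 ↔ x = y := by
  simp [eqn, mul_inv_eq_one]

theorem sends_eq_one {y x z : G} : sends y x z = 1 ↔ cj x y = z := eqn_eq_one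

theorem fixes_eq_one {y x : G} : fixes y x = 1 ↔ cj x y = x := eqn_eq_one

theorem commutes_eq_one {x y : G} : commutes x y = 1 ↔ x * y = y * x := eqn_eq_one

theorem map_cj (f : G →* H) (x y : G) : f (cj x y) = cj (f x) (f y) := by
  simp [cj]

theorem map_eqn (f : G →* H) (x y : G) : f (eqn x y) = eqn (f x) (f y) := by
  simp [eqn]

theorem map_sends (f : G →* H) (y x z : G) : f (sends y x z) = sends (f y) (f x) (f z) := by
  simp [sends, map_eqn, map_cj]

theorem map_fixes (f : G →* H) (y x : G) : f (fixes y x) = fixes (f y) (f x) :=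
  map_sends f y x x

theorem map_commutes (f : G →* H) (x y : G) : f (commutes x y) = commutes (f x) (f y) := by
  simp [commutes, map_eqn]

theorem cj_mul_right (x y z : G) : cj x (y * z) = cj (cj x y) z := by
  simp [cj, mul_assoc]

theorem cj_one (x : G) : cj x 1 = x := by simp [cj]

theorem cj_inv_right_eq {x y z : G} (h : cj x y = z) : cj z y⁻¹ = x := by
  subst h
  simp [cj, mul_assoc]

theorem cj_injective (y : G) : Function.Injective fun x : G => cj x y := by
  intro x x' h
  simpa [cj] using h

/-- Conjugation `x ↦ y⁻¹ x y` as a homomorphism. -/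
def cjHom (y : G) : G →* G := (MulAut.conj y⁻¹).toMonoidHom

theorem cjHom_apply (x y : G) : cjHom y x = cj x y := by
  simp [cjHom, cj]

theorem cj_eq_of_commute {x y : G} (h : Commute x y) : cj x y = x := by
  rw [cj, mul_assoc, h.eq, inv_mul_cancel_left]

theorem commute_of_cj_eq {x y : G} (h : cj x y = x) : Commute x y := by
  rw [cj, mul_assoc, inv_mul_eq_iff_eq_mul] at h
  exact h

/-- The elements fixed under conjugation by `y` form a subgroup. -/
def fixedBy (y : G) : Subgroup G := (cjHom y).eqLocus (MonoidHom.id G)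

theorem mem_fixedBy {x y : G} : x ∈ fixedBy y ↔ cj x y = x := by
  rw [← cjHom_apply]
  rfl

end Conjugation

/-! ### Overgroups in which given subgroups become conjugate or centralized -/

section Extensions

/-- Two embeddings of a group in `Γ` become conjugate in a larger group. -/
theorem exists_conjugating {Γ K : Type} [Group Γ] [Group K] (α β : K →* Γ)
    (hα : Function.Injective α) (hβ : Function.Injective β) :
    ∃ (Γ' : Type) (_ : Group Γ') (ι : Γ →* Γ') (t : Γ'),
      Function.Injective ι ∧ ∀ k, cj (ι (α k)) t = ι (β k) := by
  let e : α.range ≃* β.range :=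
    (MonoidHom.ofInjective hα).symm.trans (MonoidHom.ofInjective hβ)
  refine ⟨HNNExtension Γ α.range β.range e, inferInstance, HNNExtension.of, HNNExtension.t⁻¹,
    HNNExtension.of_injective _, fun k => ?_⟩
  have h := HNNExtension.equiv_eq_conj (φ := e) (MonoidHom.ofInjective hα k)
  simp only [e, MulEquiv.trans_apply, MulEquiv.symm_apply_apply, MonoidHom.ofInjective_apply] at h
  rw [h]
  simp [cj]

/-- Two points in different orbits, with the same stabilizer in `K`, are interchanged by a
permutation commuting with `K`. -/
theorem exists_perm_swap {Γ T : Type*} [Group Γ] [MulAction Γ T] (K : Subgroup Γ) (p q : T)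
    (hstab : ∀ k ∈ K, k • p = p ↔ k • q = q) (hne : ∀ k : Γ, k • p ≠ q) :
    ∃ w : Equiv.Perm T, w p = q ∧ w q = p ∧ ∀ k ∈ K, ∀ x, w (k • x) = k • w x := by
  classical
  let R : T → T → Prop := fun x y =>
    ∃ k ∈ K, (x = k • p ∧ y = k • q) ∨ (x = k • q ∧ y = k • p)
  have hsymm : ∀ x y, R x y → R y x := by
    rintro x y ⟨k, hk, h | h⟩
    · exact ⟨k, hk, Or.inr ⟨h.2, h.1⟩⟩
    · exact ⟨k, hk, Or.inl ⟨h.2, h.1⟩⟩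
  have hpq : ∀ k ∈ K, ∀ k' ∈ K, k • p = k' • p ↔ k • q = k' • q := by
    intro k hk k' hk'
    have := hstab (k'⁻¹ * k) (K.mul_mem (K.inv_mem hk') hk)
    rwa [mul_smul, mul_smul, inv_smul_eq_iff, inv_smul_eq_iff] at this
  have hdisj : ∀ k k' : Γ, k • p ≠ k' • q := by
    intro k k' h
    apply hne (k'⁻¹ * k)
    rw [mul_smul, h, inv_smul_smul]
  -- Equal stabilizers in `K` make the relation single-valued on each orbit; the mixed cases cannot
  -- occur because the orbits of `p` and `q` are disjoint.
  have hfun : ∀ x y y', R x y → R x y' → y = y' := by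
    rintro x y y' ⟨k, hk, ⟨h1, h2⟩ | ⟨h1, h2⟩⟩ ⟨k', hk', ⟨h3, h4⟩ | ⟨h3, h4⟩⟩
    · rw [h2, h4]
      exact (hpq k hk k' hk').1 (h1.symm.trans h3)
    · exact absurd (h1.symm.trans h3) (hdisj _ _)
    · exact absurd (h3.symm.trans h1) (hdisj _ _)
    · rw [h2, h4]
      exact (hpq k hk k' hk').2 (h1.symm.trans h3)
  let f : T → T := fun x => if h : ∃ y, R x y then h.choose else x
  have hf : ∀ x y, R x y → f x = y := by
    intro x y h
    have h' : ∃ y, R x y := ⟨y, h⟩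
    simp only [f, dif_pos h']
    exact hfun _ _ _ h'.choose_spec h
  have hf' : ∀ x, (¬ ∃ y, R x y) → f x = x := by
    intro x h
    simp only [f, dif_neg h]
  have hinv : Function.Involutive f := by
    intro x
    by_cases h : ∃ y, R x y
    · obtain ⟨y, hy⟩ := h
      rw [hf x y hy, hf y x (hsymm _ _ hy)]
    · rw [hf' x h, hf' x h]
  have hsmul : ∀ k ∈ K, ∀ x y, R x y → R (k • x) (k • y) := by
    rintro k hk x y ⟨k', hk', ⟨rfl, rfl⟩ | ⟨rfl, rfl⟩⟩
    · exact ⟨k * k', K.mul_mem hk hk', Or.inl ⟨(mul_smul ..).symm, (mul_smul ..).symm⟩⟩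
    · exact ⟨k * k', K.mul_mem hk hk', Or.inr ⟨(mul_smul ..).symm, (mul_smul ..).symm⟩⟩
  refine ⟨hinv.toPerm, hf _ _ ⟨1, K.one_mem, Or.inl (by simp)⟩,
    hf _ _ ⟨1, K.one_mem, Or.inr (by simp)⟩, fun k hk x => ?_⟩
  change f (k • x) = k • f x
  by_cases h : ∃ y, R x y
  · obtain ⟨y, hy⟩ := h
    rw [hf x y hy, hf _ _ (hsmul k hk x y hy)]
  · rw [hf' x h, hf']
    rintro ⟨y, hy⟩
    exact h ⟨k⁻¹ • y, by simpa using hsmul k⁻¹ (K.inv_mem hk) _ _ hy⟩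

/-- If `G₀ ∩ Kᵢ ≤ H ≤ G₀` for `i = 1, 2`, then in a larger group there are elements `wᵢ`
centralizing `Kᵢ` such that the conjugates of `G₀` by `w₁` and `w₂` generate a subgroup that meets
the given group in `H`. -/
theorem exists_centralizing_pair {Γ : Type} [Group Γ] (G₀ H K₁ K₂ : Subgroup Γ) (hH : H ≤ G₀)
    (h₁ : K₁ ⊓ G₀ ≤ H) (h₂ : K₂ ⊓ G₀ ≤ H) :
    ∃ (Γ' : Type) (_ : Group Γ') (ι : Γ →* Γ') (w₁ w₂ : Γ') (J : Subgroup Γ'),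
      Function.Injective ι ∧ (∀ k ∈ K₁, cj (ι k) w₁ = ι k) ∧ (∀ k ∈ K₂, cj (ι k) w₂ = ι k) ∧
      (∀ x ∈ G₀, cj (ι x) w₁ ∈ J) ∧ (∀ x ∈ G₀, cj (ι x) w₂ ∈ J) ∧ ∀ x, ι x ∈ J → x ∈ H := by
  -- The points `p` and `q` have stabilizers `H` and `G₀`. A permutation exchanging them conjugates
  -- `G₀` into the stabilizer of `p`, and that stabilizer meets `Γ` in `H`.
  let T := (Γ ⧸ G₀) ⊕ (Γ ⧸ H)
  let p : T := Sum.inr ((1 : Γ) : Γ ⧸ H)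
  let q : T := Sum.inl ((1 : Γ) : Γ ⧸ G₀)
  have hxp : ∀ x : Γ, x • p = Sum.inr (x : Γ ⧸ H) := fun x =>
    congrArg (fun y : Γ => (Sum.inr (y : Γ ⧸ H) : T)) (mul_one x)
  have hxq : ∀ x : Γ, x • q = Sum.inl (x : Γ ⧸ G₀) := fun x =>
    congrArg (fun y : Γ => (Sum.inl (y : Γ ⧸ G₀) : T)) (mul_one x)
  have hp : ∀ x : Γ, x • p = p ↔ x ∈ H := by
    intro x
    rw [hxp, Sum.inr.injEq, eq_comm, QuotientGroup.eq, inv_one, one_mul]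
  have hq : ∀ x : Γ, x • q = q ↔ x ∈ G₀ := by
    intro x
    rw [hxq, Sum.inl.injEq, eq_comm, QuotientGroup.eq, inv_one, one_mul]
  have key : ∀ K : Subgroup Γ, K ⊓ G₀ ≤ H → ∃ w : Equiv.Perm T, w p = q ∧ w q = p ∧
      ∀ k ∈ K, ∀ x, w (k • x) = k • w x := by
    intro K hK
    refine exists_perm_swap K p q (fun k hk => ?_) (fun k => ?_)
    · rw [hp, hq]
      exact ⟨fun h => hH h, fun h => hK ⟨hk, h⟩⟩
    · rw [hxp]
      exact Sum.inr_ne_inl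
  obtain ⟨w₁, hw₁, hw₁', hK₁⟩ := key K₁ h₁
  obtain ⟨w₂, hw₂, hw₂', hK₂⟩ := key K₂ h₂
  -- The second factor keeps `ι` injective even if the action on `T` is not faithful.
  let ι : Γ →* Equiv.Perm T × Γ := (MulAction.toPermHom Γ T).prod (MonoidHom.id Γ)
  have hι : ∀ x, ι x = (MulAction.toPerm x, x) := fun _ => rfl
  let J : Subgroup (Equiv.Perm T × Γ) :=
    (MulAction.stabilizer (Equiv.Perm T) p).comap (MonoidHom.fst _ _)
  have hcomm : ∀ (w : Equiv.Perm T) (k : Γ), (∀ x, w (k • x) = k • w x) →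
      cj (ι k) (w, 1) = ι k := by
    intro w k h
    refine cj_eq_of_commute (Prod.ext (Equiv.ext fun x => ?_) ?_)
    · simpa [hι] using (h x).symm
    · simp [hι]
  have hJ : ∀ (w : Equiv.Perm T) (x : Γ), x ∈ G₀ → w p = q → cj (ι x) (w, 1) ∈ J := by
    intro w x hx hw
    simp only [J, Subgroup.mem_comap, MonoidHom.coe_fst, MulAction.mem_stabilizer_iff,
      Equiv.Perm.smul_def]
    simp only [cj, hι, Prod.fst_mul, Prod.fst_inv, Equiv.Perm.mul_apply, MulAction.toPerm_apply]
    rw [Equiv.Perm.inv_eq_iff_eq, hw, (hq x).2 hx]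
  refine ⟨Equiv.Perm T × Γ, inferInstance, ι, (w₁, 1), (w₂, 1), J, fun x y h => ?_,
    fun k hk => hcomm _ _ (hK₁ k hk), fun k hk => hcomm _ _ (hK₂ k hk),
    fun x hx => hJ _ _ hx hw₁, fun x hx => hJ _ _ hx hw₂, fun x hx => ?_⟩
  · exact (Prod.ext_iff.1 h).2
  · rw [← hp]
    simpa [J, hι] using hx

/-- In a larger group there is an element `v` centralizing the subgroup `M` and no further element
of the group, in the strong sense that `x ^ v` lies in the group for `x ∈ M` only. -/
theorem exists_centralizing {Γ : Type} [Group Γ] (M : Subgroup Γ) :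
    ∃ (Γ' : Type) (_ : Group Γ') (ι : Γ →* Γ') (v : Γ'), Function.Injective ι ∧
      (∀ k ∈ M, cj (ι k) v = ι k) ∧ ∀ x y, cj (ι x) v = ι y → x ∈ M ∧ x = y := by
  -- With `G₀ = ⊤` all conjugates `x ^ v` lie in `J`, and `J` meets `Γ` inside `M`. So `x ^ v = y`
  -- forces `y ∈ M`, whence `y = y ^ v` and `x = y`.
  obtain ⟨Γ', _, ι, v, -, J, hι, hv, -, hJ, -, hJM⟩ :=
    exists_centralizing_pair (⊤ : Subgroup Γ) M M ⊥ le_top inf_le_left (by simp)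
  refine ⟨Γ', _, ι, v, hι, hv, fun x y h => ?_⟩
  have hy : y ∈ M := hJM y (h ▸ hJ x trivial)
  have hxy : x = y := hι (cj_injective v (h.trans (hv y hy).symm))
  exact ⟨hxy ▸ hy, hxy⟩

end Extensions

/-! ### The elements `b_f` and `a_f` -/

section WordsOfFunctions

theorem cj_pow_left {G : Type*} [Group G] (x y : G) (n : ℤ) : cj x y ^ n = cj (x ^ n) y := by
  rw [← cjHom_apply, ← cjHom_apply, map_zpow]

theorem bI_zero : bI 0 = FreeGroup.of FLetter.b := by
  simp [bI, cj]

theorem cj_bI (i j : ℤ) : cj (bI i) (FreeGroup.of FLetter.c ^ j) = bI (i + j) := by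
  rw [bI, bI, ← cj_mul_right, ← zpow_add]

theorem prod_filter_support (f : E) (l : List ℤ) :
    ((l.filter fun i => f i ≠ 0).map fun i => bI i ^ f i).prod =
      (l.map fun i => bI i ^ f i).prod := by
  induction l with
  | nil => rfl
  | cons i l ih =>
    by_cases h : f i = 0
    · simp [h, ← ih]
    · simp [h, ← ih]

theorem bF_eq_prod (f : E) (l : List ℤ) (hl : l.Pairwise (· < ·)) (h : ∀ i, f i ≠ 0 → i ∈ l) :
    bF f = (l.map fun i => bI i ^ f i).prod := by
  rw [← prod_filter_support, bF]
  have hl' : (l.filter fun i => f i ≠ 0).Pairwise (· < ·) := hl.filter _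
  have hs : f.support = (l.filter fun i => f i ≠ 0).toFinset := by
    ext i
    simp only [Finsupp.mem_support_iff, List.mem_toFinset, List.mem_filter, decide_eq_true_eq]
    exact ⟨fun hi => ⟨h i hi, hi⟩, fun hi => hi.2⟩
  rw [hs, (List.toFinset_sort (· ≤ ·) (hl'.imp ne_of_lt)).2 (hl'.imp le_of_lt)]

/-- The shift `f ↦ f(· - 1)` of functions. -/
def shift : E ≃+ E := Finsupp.domCongr (Equiv.addRight 1)

theorem shift_apply (f : E) (i : ℤ) : shift f i = f (i - 1) := by
  simp [shift, Finsupp.domCongr, Finsupp.equivMapDomain_apply, sub_eq_add_neg]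

theorem shift_single (i n : ℤ) : shift (Finsupp.single i n) = Finsupp.single (i + 1) n := by
  simp [shift, Finsupp.domCongr]

theorem bF_shift (f : E) : bF (shift f) = cj (bF f) (FreeGroup.of FLetter.c) := by
  rw [bF_eq_prod (shift f) ((f.support.sort (· ≤ ·)).map (· + 1))]
  · rw [bF, ← cjHom_apply, map_list_prod, List.map_map, List.map_map]
    congr 1
    refine List.map_congr_left fun i _ => ?_
    have := cj_bI i 1
    rw [zpow_one] at this
    simp [shift_apply, cjHom_apply, ← cj_pow_left, this]
  · have h := Finset.sortedLT_sort f.support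
    refine List.Pairwise.map _ (fun i j hij => ?_) h.pairwise
    exact Int.add_lt_add_right hij 1
  · intro i hi
    rw [shift_apply] at hi
    exact List.mem_map.2 ⟨i - 1, by simpa using hi, by simp⟩

theorem bF_zero : bF 0 = 1 := by simp [bF]

theorem aF_zero : aF 0 = FreeGroup.of FLetter.a := by simp [aF, bF_zero, cj_one]

/-- The product is cut at index `0` because `d` acts differently on the `b_i` on the two sides; `x`
and `y` serve all `k` at once. -/
theorem exists_bF_add_single (f : E) :
    ∃ x ∈ Subgroup.closure (bI '' Set.Iio 0), ∃ y ∈ Subgroup.closure (bI '' Set.Ioi 0),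
      ∀ k : ℤ, bF (f + Finsupp.single 0 k) = x * FreeGroup.of FLetter.b ^ (f 0 + k) * y := by
  have hs := (Finset.sortedLT_sort f.support).pairwise
  set l := f.support.sort (· ≤ ·) with hl
  refine ⟨((l.filter (· < 0)).map fun i => bI i ^ f i).prod, ?_,
    ((l.filter (0 < ·)).map fun i => bI i ^ f i).prod, ?_, fun k => ?_⟩
  · refine Subgroup.list_prod_mem _ fun z hz => ?_
    obtain ⟨i, hi, rfl⟩ := List.mem_map.1 hz
    exact Subgroup.zpow_mem _ (Subgroup.subset_closure
      (Set.mem_image_of_mem bI (by simpa using (List.mem_filter.1 hi).2))) _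
  · refine Subgroup.list_prod_mem _ fun z hz => ?_
    obtain ⟨i, hi, rfl⟩ := List.mem_map.1 hz
    exact Subgroup.zpow_mem _ (Subgroup.subset_closure
      (Set.mem_image_of_mem bI (by simpa using (List.mem_filter.1 hi).2))) _
  · rw [bF_eq_prod _ (l.filter (· < 0) ++ 0 :: l.filter (0 < ·))]
    · have hmap : ∀ l' : List ℤ, (∀ i ∈ l', i ≠ 0) →
          (l'.map fun i => bI i ^ (f + Finsupp.single 0 k : E) i) = l'.map fun i => bI i ^ f i := by
        intro l' h
        refine List.map_congr_left fun i hi => ?_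
        simp [(h i hi).symm]
      rw [List.map_append, List.map_cons, List.prod_append, List.prod_cons, hmap, hmap, bI_zero]
      · simp [mul_assoc]
      · intro i hi
        exact ne_of_gt (by simpa using (List.mem_filter.1 hi).2)
      · intro i hi
        exact ne_of_lt (by simpa using (List.mem_filter.1 hi).2)
    · rw [List.pairwise_append, List.pairwise_cons]
      refine ⟨hs.filter _, ⟨fun i hi => by simpa using (List.mem_filter.1 hi).2, hs.filter _⟩, ?_⟩
      intro i hi j hj
      have hi' : i < 0 := by simpa using (List.mem_filter.1 hi).2
      rcases List.mem_cons.1 hj with rfl | hj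
      · exact hi'
      · exact hi'.trans (by simpa using (List.mem_filter.1 hj).2)
    · intro i hi
      rcases lt_trichotomy i 0 with h | rfl | h
      · have : f i ≠ 0 := by simpa [Finsupp.single_apply, h.ne'] using hi
        simp [hl, h, this]
      · simp
      · have : f i ≠ 0 := by simpa [Finsupp.single_apply, h.ne] using hi
        simp [hl, h, this]

/-- A property of functions that is invariant under the shift and under changes at `0` holds for all
functions if it holds for one. -/
theorem E_induction {P : E → Prop} (h0 : P 0) (hsingle : ∀ f, P f ↔ P (f + Finsupp.single 0 1))
    (hshift : ∀ f, P f ↔ P (shift f)) (f : E) : P f := by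
  have hk : ∀ (k : ℤ) (f : E), P f ↔ P (f + Finsupp.single 0 k) := by
    intro k
    induction k with
    | zero => simp
    | succ k ih =>
      intro f
      rw [ih f, hsingle, add_assoc, ← Finsupp.single_add]
    | pred k ih =>
      intro f
      rw [ih f, hsingle (f + Finsupp.single 0 (-(k : ℤ) - 1)), add_assoc, ← Finsupp.single_add,
        sub_add_cancel]
  -- A change at `i` is a change at `0` transported by shifts.
  have hi : ∀ (i k : ℤ) (f : E), P f ↔ P (f + Finsupp.single i k) := by
    intro i
    induction i with
    | zero => exact hk
    | succ i ih =>
      intro k f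
      obtain ⟨f, rfl⟩ := shift.surjective f
      rw [← shift_single, ← map_add, ← hshift, ← hshift, ← ih]
    | pred i ih =>
      intro k f
      rw [hshift, hshift (_ + _), map_add, shift_single, sub_add_cancel, ← ih]
  induction f using Finsupp.induction with
  | zero => exact h0
  | single_add i k f _ _ ih => rw [add_comm]; exact (hi i k f).1 ih

end WordsOfFunctions

/-! ### Consequences of the relations of `𝒜` -/

section RelationsA

variable {G : Type*} [Group G]

/-- The homomorphism from `F` given by a choice of elements for the nine generators. -/
def ofA (g : ALetter → G) : F →* G := FreeGroup.lift fun x => g x.toA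

@[simp] theorem ofA_a (g : ALetter → G) : ofA g (FreeGroup.of .a) = g .a := by
  simp [ofA, FLetter.toA]

@[simp] theorem ofA_b (g : ALetter → G) : ofA g (FreeGroup.of .b) = g .b := by
  simp [ofA, FLetter.toA]

@[simp] theorem ofA_c (g : ALetter → G) : ofA g (FreeGroup.of .c) = g .c := by
  simp [ofA, FLetter.toA]

/-- The elements `g` satisfy the relations of `𝒜`. -/
structure SatisfiesA (g : ALetter → G) : Prop where
  t_b : cj (g .b) (g .t) = g .b
  s_b : cj (g .b) (g .s) = cj (g .b) (g .c)⁻¹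
  t_c : cj (g .c) (g .t) = g .c ^ 2
  s_c : cj (g .c) (g .s) = g .c ^ 2
  u₁_b : cj (cj (g .b) (g .c)) (g .u₁) = cj (g .b) (g .c)
  u₁_t : cj (g .t) (g .u₁) = g .t
  u₁_s : cj (g .s) (g .u₁) = g .s
  u₂_a : cj (g .a) (g .u₂) = g .a
  u₂_b : cj (g .b) (g .u₂) = g .b
  u₂_t : cj (g .t) (g .u₂) = g .t
  u₂_s : cj (g .s) (g .u₂) = g .s
  d_a₁ : cj (cj (g .a) (g .u₁)) (g .d) = cj (g .a) (g .u₁)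
  d_b₁ : cj (cj (g .b) (g .u₁)) (g .d) = cj (g .b) (g .u₁)
  d_c₁ : cj (cj (g .c) (g .u₁)) (g .d) = cj (g .c) (g .u₁)
  d_a₂ : cj (cj (g .a) (g .u₂)) (g .d) = cj (g .a) (g .b * g .u₂)
  d_b₂ : cj (cj (g .b) (g .u₂)) (g .d) = cj (g .b) (g .u₂)
  d_c₂ : cj (cj (g .c) (g .u₂)) (g .d) = cj (g .c) (g .b * g .u₂)
  e_a : cj (g .a) (g .e) = g .a
  e_b : cj (g .b) (g .e) = cj (g .b) (g .c)
  e_c : cj (g .c) (g .e) = g .c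

theorem satisfiesA_iff {g : ALetter → G} : SatisfiesA g ↔ ∀ r ∈ relatorsA g, r = 1 := by
  simp only [relatorsA, List.forall_mem_cons, sends_eq_one, fixes_eq_one]
  constructor
  · rintro ⟨h1, h2, h3, h4, h5, h6, h7, h8, h9, h10, h11, h12, h13, h14, h15, h16, h17, h18, h19,
      h20⟩
    exact ⟨h1, h2, h3, h4, h5, h6, h7, h8, h9, h10, h11, h12, h13, h14, h15, h16, h17, h18, h19,
      h20, by simp⟩
  · rintro ⟨h1, h2, h3, h4, h5, h6, h7, h8, h9, h10, h11, h12, h13, h14, h15, h16, h17, h18, h19,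
      h20, -⟩
    exact ⟨h1, h2, h3, h4, h5, h6, h7, h8, h9, h10, h11, h12, h13, h14, h15, h16, h17, h18, h19,
      h20⟩

theorem map_relatorsA {H : Type*} [Group H] (f : G →* H) (g : ALetter → G) :
    (relatorsA g).map f = relatorsA fun x => f (g x) := by
  simp [relatorsA, map_sends, map_fixes, map_cj]

theorem SatisfiesA.map {H : Type*} [Group H] {g : ALetter → G} (hg : SatisfiesA g) (f : G →* H) :
    SatisfiesA fun x => f (g x) := by
  rw [satisfiesA_iff] at hg ⊢
  rw [← map_relatorsA]
  intro r hr
  obtain ⟨r', hr', rfl⟩ := List.mem_map.1 hr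
  rw [hg r' hr', map_one]

namespace SatisfiesA

variable {g : ALetter → G}

/-- Squaring `c` doubles indices: `t` acts by `i ↦ 2i`, `s` by `i ↦ 2i - 1`. Both maps preserve the
positive and the nonpositive integers, and these two classes are generated by the fixed points `1`
and `0` respectively. -/
theorem cj_bI_t (hg : SatisfiesA g) (i : ℤ) : cj (ofA g (bI i)) (g .t) = ofA g (bI (2 * i)) := by
  simp only [bI, map_cj, map_zpow, ofA_b, ofA_c]
  rw [← cjHom_apply, map_cj, map_zpow, cjHom_apply, cjHom_apply, hg.t_b, hg.t_c]
  rw [zpow_mul, zpow_ofNat]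

theorem cj_bI_s (hg : SatisfiesA g)
    (i : ℤ) : cj (ofA g (bI i)) (g .s) = ofA g (bI (2 * i - 1)) := by
  simp only [bI, map_cj, map_zpow, ofA_b, ofA_c]
  rw [← cjHom_apply, map_cj, map_zpow, cjHom_apply, cjHom_apply, hg.s_b, hg.s_c, ← cj_mul_right]
  congr 1
  rw [sub_eq_neg_add, zpow_add, zpow_neg_one, zpow_mul, zpow_ofNat]

theorem bI_mem_of_pos (hg : SatisfiesA g)
    {K : Subgroup G} (ht : g .t ∈ K) (hs : g .s ∈ K) (h1 : ofA g (bI 1) ∈ K)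
    (i : ℤ) (hi : 0 < i) : ofA g (bI i) ∈ K := by
  induction h : i.natAbs using Nat.strong_induction_on generalizing i with
  | _ n ih =>
    rcases Int.even_or_odd' i with ⟨m, rfl | rfl⟩
    · rw [← hg.cj_bI_t]
      have := ih m.natAbs (by omega) m (by omega) rfl
      exact K.mul_mem (K.mul_mem (K.inv_mem ht) this) ht
    -- The descent stops at index `1`, the fixed point of `i ↦ 2i - 1`.
    · by_cases hm : m = 0
      · subst hm; exact h1
      · rw [show 2 * m + 1 = 2 * (m + 1) - 1 by ring, ← hg.cj_bI_s]
        have := ih (m + 1).natAbs (by omega) (m + 1) (by omega) rfl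
        exact K.mul_mem (K.mul_mem (K.inv_mem hs) this) hs

theorem bI_mem_of_nonpos (hg : SatisfiesA g)
    {K : Subgroup G} (ht : g .t ∈ K) (hs : g .s ∈ K) (h0 : ofA g (bI 0) ∈ K)
    (i : ℤ) (hi : i ≤ 0) : ofA g (bI i) ∈ K := by
  induction h : i.natAbs using Nat.strong_induction_on generalizing i with
  | _ n ih =>
    rcases Int.even_or_odd' i with ⟨m, rfl | rfl⟩
    · by_cases hm : m = 0
      · subst hm; exact h0
      · rw [← hg.cj_bI_t]
        have := ih m.natAbs (by omega) m (by omega) rfl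
        exact K.mul_mem (K.mul_mem (K.inv_mem ht) this) ht
    · rw [show 2 * m + 1 = 2 * (m + 1) - 1 by ring, ← hg.cj_bI_s]
      have := ih (m + 1).natAbs (by omega) (m + 1) (by omega) rfl
      exact K.mul_mem (K.mul_mem (K.inv_mem hs) this) hs

/-- `u₁` fixes `b_1`, `t`, `s`, hence all `b_i` with `i > 0`; these therefore lie in `F ^ u₁`, which
`d` centralizes. -/
theorem cj_d_of_pos (hg : SatisfiesA g) {x : F} (hx : x ∈ Subgroup.closure (bI '' Set.Ioi 0)) :
    cj (ofA g x) (g .d) = ofA g x := by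
  have hu : Subgroup.closure (bI '' Set.Ioi 0) ≤ (fixedBy (g .u₁)).comap (ofA g) := by
    rw [Subgroup.closure_le]
    rintro _ ⟨i, hi, rfl⟩
    refine hg.bI_mem_of_pos (mem_fixedBy.2 hg.u₁_t) (mem_fixedBy.2 hg.u₁_s) ?_ i hi
    rw [mem_fixedBy]
    simpa [bI, map_cj] using hg.u₁_b
  have hd : (cjHom (g .d)).comp ((cjHom (g .u₁)).comp (ofA g)) = (cjHom (g .u₁)).comp (ofA g) := by
    ext x
    cases x
    · simpa [cjHom_apply] using hg.d_a₁
    · simpa [cjHom_apply] using hg.d_b₁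
    · simpa [cjHom_apply] using hg.d_c₁
  have h := DFunLike.congr_fun hd x
  simp only [MonoidHom.comp_apply, cjHom_apply] at h
  rwa [mem_fixedBy.1 (hu hx)] at h

/-- `d` takes `x ^ u₂` to `x ^ (b u₂)`. As `b` and `u₂` commute, the latter is `(x ^ u₂) ^ b`, and
`x ^ u₂ = x`. -/
theorem cj_d_of_fixedBy (hg : SatisfiesA g) {x : F} (hx : ofA g x ∈ fixedBy (g .u₂)) :
    cj (ofA g x) (g .d) = cj (ofA g x) (g .b) := by
  have hd : (cjHom (g .d)).comp ((cjHom (g .u₂)).comp (ofA g)) =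
      (cjHom (g .b * g .u₂)).comp (ofA g) := by
    ext x
    cases x
    · simpa [cjHom_apply] using hg.d_a₂
    · simpa [cjHom_apply, cj_mul_right, cj_eq_of_commute (Commute.refl _)] using hg.d_b₂
    · simpa [cjHom_apply] using hg.d_c₂
  have h := DFunLike.congr_fun hd x
  simp only [MonoidHom.comp_apply, cjHom_apply] at h
  rw [mem_fixedBy.1 hx, (commute_of_cj_eq hg.u₂_b).eq, cj_mul_right, mem_fixedBy.1 hx] at h
  exact h

theorem cj_d_of_neg (hg : SatisfiesA g) {x : F} (hx : x ∈ Subgroup.closure (bI '' Set.Iio 0)) :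
    cj (ofA g x) (g .d) = cj (ofA g x) (g .b) := by
  have hu : Subgroup.closure (bI '' Set.Iio 0) ≤ (fixedBy (g .u₂)).comap (ofA g) := by
    rw [Subgroup.closure_le]
    rintro _ ⟨i, hi, rfl⟩
    refine hg.bI_mem_of_nonpos (mem_fixedBy.2 hg.u₂_t) (mem_fixedBy.2 hg.u₂_s) ?_ i (le_of_lt hi)
    rw [mem_fixedBy]
    simpa [bI, map_cj, cj_one] using hg.u₂_b
  exact hg.cj_d_of_fixedBy (hu hx)

/-- Write `b_f = x b^{f(0)} y`. Conjugation by `d` replaces `x` by `b⁻¹xb` and fixes `b` and `y`, so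
`b_f` becomes `b⁻¹ x b^{f(0)+1} y`. The factor `b⁻¹` cancels against the `b` in `a ^ d = a ^ b`. -/
theorem cj_aF_d (hg : SatisfiesA g) (f : E) :
    cj (ofA g (aF f)) (g .d) = ofA g (aF (f + Finsupp.single 0 1)) := by
  obtain ⟨x, hx, y, hy, h⟩ := exists_bF_add_single f
  have h0 := h 0
  rw [Finsupp.single_zero, add_zero, add_zero] at h0
  rw [aF, aF, h 1, h0]
  have ha : cj (g .a) (g .d) = cj (g .a) (g .b) := by
    simpa using hg.cj_d_of_fixedBy (x := FreeGroup.of .a) (by simpa [mem_fixedBy] using hg.u₂_a)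
  have hb : cj (g .b) (g .d) = g .b := by
    simpa [cj_eq_of_commute (Commute.refl _)] using
      hg.cj_d_of_fixedBy (x := FreeGroup.of .b) (by simpa [mem_fixedBy] using hg.u₂_b)
  rw [← cjHom_apply]
  simp only [map_cj, map_mul, map_zpow, ofA_a, ofA_b, cjHom_apply]
  rw [ha, hb, hg.cj_d_of_neg hx, hg.cj_d_of_pos hy, ← cj_mul_right]
  congr 1
  rw [zpow_add_one, ← Commute.self_zpow]
  simp [cj, mul_assoc]

theorem cj_aF_e (hg : SatisfiesA g) (f : E) : cj (ofA g (aF f)) (g .e) = ofA g (aF (shift f)) := by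
  let ε : F →* F := FreeGroup.lift fun
    | .a => FreeGroup.of .a
    | .b => cj (FreeGroup.of .b) (FreeGroup.of .c)
    | .c => FreeGroup.of .c
  have he : (cjHom (g .e)).comp (ofA g) = (ofA g).comp ε := by
    ext x
    cases x
    · simpa [ε, cjHom_apply] using hg.e_a
    · simpa [ε, cjHom_apply, map_cj] using hg.e_b
    · simpa [ε, cjHom_apply] using hg.e_c
  have hε : ∀ i, ε (bI i) = cj (bI i) (FreeGroup.of .c) := by
    intro i
    simp only [bI, map_cj, map_zpow, ε, FreeGroup.lift_apply_of, ← cj_mul_right,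
      ← zpow_one_add, ← zpow_add_one, add_comm]
  have hb : ε (bF f) = bF (shift f) := by
    rw [bF_shift, bF, ← cjHom_apply, map_list_prod, map_list_prod, List.map_map, List.map_map]
    congr 1
    refine List.map_congr_left fun i _ => ?_
    simp [hε, cjHom_apply, cj_pow_left]
  have h := DFunLike.congr_fun he (aF f)
  rw [MonoidHom.comp_apply, cjHom_apply, MonoidHom.comp_apply] at h
  rw [h, aF, aF, map_cj, hb]
  simp [ε]

end SatisfiesA

end RelationsA

/-! ### The elements `a_f` generate a free group -/

section Freeness

/-- The homomorphism sending the free generator indexed by `f` to `a_f`. -/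
def freeA : FreeGroup E →* F := FreeGroup.lift aF

@[simp] theorem freeA_of (f : E) : freeA (FreeGroup.of f) = aF f := by simp [freeA]

/-- Permutations acting on a free basis. -/
def permAut (α : Type) : Equiv.Perm α →* MulAut (FreeGroup α) where
  toFun := FreeGroup.freeGroupCongr
  map_one' := FreeGroup.freeGroupCongr_refl
  map_mul' x y := (FreeGroup.freeGroupCongr_trans y x).symm

@[simp] theorem permAut_of {α : Type} (π : Equiv.Perm α) (x : α) :
    permAut α π (FreeGroup.of x) = FreeGroup.of (π x) := by
  simp [permAut]

/-- Since conjugation is `y⁻¹xy`, a basis element moves by the inverse permutation; the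
representations below therefore use inverse translations and inverse shifts. -/
theorem cj_inl_of_inr {α G : Type} [Group G] (φ : G →* Equiv.Perm α) (x : α) (y : G) :
    cj (SemidirectProduct.inl (FreeGroup.of x)) (SemidirectProduct.inr y) =
      (SemidirectProduct.inl (FreeGroup.of ((φ y)⁻¹ x)) :
        FreeGroup α ⋊[(permAut α).comp φ] G) := by
  rw [cj, ← map_inv, ← map_inv, ← permAut_of, ← MonoidHom.comp_apply, SemidirectProduct.inl_aut,
    inv_inv]

/-- `F` is mapped to the free group on `E` extended by permutations of the basis: `a` goes to the
basis element `0`, `b` to a translation, `c` to a shift. Then `b_f` becomes translation by `f`, and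
`a_f` the basis element `f`. -/
theorem freeA_injective : Function.Injective freeA := by
  let tr : Multiplicative E →* Equiv.Perm E :=
    { toFun := fun f => Equiv.subRight f.toAdd
      map_one' := by ext; simp
      map_mul' := fun f h => by
        ext x : 1
        simp [sub_sub, add_comm] }
  have htr : ∀ f x : E, tr (Multiplicative.ofAdd f) x = x - f := fun _ _ => rfl
  let Φ : F →* FreeGroup E ⋊[(permAut E).comp (MonoidHom.id (Equiv.Perm E))] Equiv.Perm E :=
    FreeGroup.lift fun
    | .a => SemidirectProduct.inl (FreeGroup.of 0)
    | .b => SemidirectProduct.inr (tr (Multiplicative.ofAdd (Finsupp.single 0 1)))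
    | .c => SemidirectProduct.inr shift.symm.toEquiv
  have hcj : ∀ x : E, cj (tr (Multiplicative.ofAdd x)) shift.symm.toEquiv =
      tr (Multiplicative.ofAdd (shift x)) := by
    intro x
    refine Equiv.ext fun y => ?_
    change shift (shift.symm y - x) = y - shift x
    rw [map_sub, AddEquiv.apply_symm_apply]
  have hbI : ∀ i, cj (tr (Multiplicative.ofAdd (Finsupp.single 0 1))) (shift.symm.toEquiv ^ i) =
      tr (Multiplicative.ofAdd (Finsupp.single i 1)) := by
    intro i
    induction i with
    | zero => simp [cj_one]
    | succ i ih => rw [zpow_add_one, cj_mul_right, ih, hcj, shift_single]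
    | pred i ih =>
      rw [zpow_sub_one, cj_mul_right, ih]
      refine cj_inv_right_eq ?_
      rw [hcj, shift_single, sub_add_cancel]
  have hΦ : ∀ f, Φ (bF f) = SemidirectProduct.inr (tr (Multiplicative.ofAdd f)) := by
    intro f
    have h1 : ∀ i, Φ (bI i ^ f i) =
        SemidirectProduct.inr (tr (Multiplicative.ofAdd (Finsupp.single i (f i)))) := by
      intro i
      have : Φ (bI i) = SemidirectProduct.inr (tr (Multiplicative.ofAdd (Finsupp.single i 1))) := by
        rw [← hbI, map_cj, map_zpow, bI, map_cj, map_zpow]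
        simp [Φ]
      rw [map_zpow, this, ← map_zpow, ← map_zpow, ← ofAdd_zsmul, Finsupp.smul_single]
      simp
    have h2 : (Multiplicative.ofAdd f) = ((f.support.sort (· ≤ ·)).map
        fun i => Multiplicative.ofAdd (Finsupp.single i (f i))).prod := by
      rw [← Multiset.prod_coe, ← Multiset.map_coe, Finset.sort_eq]
      conv_lhs => rw [← Finsupp.sum_single f]
      exact ofAdd_sum _ _
    rw [bF, map_list_prod, List.map_map, h2, map_list_prod, map_list_prod, List.map_map,
      List.map_map]
    congr 1
    exact List.map_congr_left fun i _ => h1 i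
  have hcomp : ∀ x, Φ (freeA x) = SemidirectProduct.inl x := by
    intro x
    have : Φ.comp freeA = SemidirectProduct.inl := by
      ext f : 1
      rw [MonoidHom.comp_apply, freeA_of, aF, map_cj, hΦ]
      simp only [Φ, FreeGroup.lift_apply_of]
      rw [cj_inl_of_inr]
      congr 2
      rw [MonoidHom.id_apply, Equiv.Perm.inv_eq_iff_eq, htr, sub_self]
    exact DFunLike.congr_fun this x
  intro x y h
  exact SemidirectProduct.inl_injective (by rw [← hcomp, ← hcomp, h])

theorem map_freeA_closure (X : Set E) :
    (Subgroup.closure (FreeGroup.of '' X)).map freeA = subgroupA X := by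
  rw [MonoidHom.map_closure, subgroupA, Set.image_image]
  simp

end Freeness

/-! ### The group generated by `a, b, c, t, s, u₁, u₂` -/

section Doubling

variable {α : Type*}

/-- The endomorphism of a free group that squares the free generators. -/
def doubling (α : Type*) : FreeGroup α →* FreeGroup α := FreeGroup.lift fun x => FreeGroup.of x ^ 2

@[simp] theorem doubling_of (x : α) : doubling α (FreeGroup.of x) = FreeGroup.of x ^ 2 := by
  simp [doubling]

theorem doubling_mk (L : List (α × Bool)) :
    doubling α (FreeGroup.mk L) = FreeGroup.mk (L.flatMap fun p => [p, p]) := by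
  induction L with
  | nil => exact map_one _
  | cons p L ih =>
    have h : ∀ (q : α × Bool) (L' : List (α × Bool)),
        FreeGroup.mk (q :: L') = FreeGroup.mk [q] * FreeGroup.mk L' := by
      intro q L'
      rw [FreeGroup.mul_mk, List.singleton_append]
    have h1 : doubling α (FreeGroup.mk [p]) = FreeGroup.mk [p, p] := by
      obtain ⟨x, _ | _⟩ := p
      · have : (FreeGroup.mk [(x, false)]) = (FreeGroup.of x)⁻¹ := rfl
        rw [this, map_inv, doubling_of]
        rfl
      · exact doubling_of x
    rw [h, map_mul, h1, ih, FreeGroup.mul_mk]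
    rfl

theorem isReduced_double {L : List (α × Bool)} (h : FreeGroup.IsReduced L) :
    FreeGroup.IsReduced (L.flatMap fun p => [p, p]) := by
  induction L with
  | nil => exact h
  | cons p L ih =>
    cases L with
    | nil => simp [FreeGroup.IsReduced]
    | cons q L =>
      simp only [FreeGroup.IsReduced, List.isChain_cons_cons, List.flatMap_cons,
        List.cons_append, List.nil_append] at h ih ⊢
      exact ⟨fun _ => trivial, h.1, ih h.2⟩

/-- A reduced word with every letter repeated is still reduced, so a nontrivial element has
nontrivial image. -/
theorem doubling_injective : Function.Injective (doubling α) := by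
  classical
  rw [injective_iff_map_eq_one]
  intro x hx
  rw [← FreeGroup.mk_toWord (x := x), doubling_mk, ← FreeGroup.toWord_eq_nil_iff,
    FreeGroup.toWord_mk, (isReduced_double FreeGroup.isReduced_toWord).reduce_eq,
    List.flatMap_eq_nil_iff] at hx
  rw [← FreeGroup.toWord_eq_nil_iff, List.eq_nil_iff_forall_not_mem]
  intro p hp
  simpa using hx p hp

/-- The exponent sum of `x` shows that `n` is even; injectivity of the doubling then determines `v`.
-/
theorem eq_zpow_of_doubling_eq [DecidableEq α] {v : FreeGroup α} {x : α} {n : ℤ}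
    (h : doubling α v = FreeGroup.of x ^ n) : ∃ m, n = 2 * m ∧ v = FreeGroup.of x ^ m := by
  let φ : FreeGroup α →* Multiplicative ℤ :=
    FreeGroup.lift fun y => if y = x then Multiplicative.ofAdd 1 else 1
  have hφ : φ.comp (doubling α) = (powMonoidHom 2).comp φ := by
    ext y
    simp [φ]
  have hn : n = 2 * (φ v).toAdd := by
    have h1 := congrArg (fun y => (φ y).toAdd) h
    have h2 := congrArg Multiplicative.toAdd (DFunLike.congr_fun hφ v)
    simp only [MonoidHom.comp_apply, powMonoidHom_apply, toAdd_pow] at h2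
    simp only [h2, map_zpow, φ, FreeGroup.lift_apply_of, if_true, toAdd_zpow, toAdd_ofAdd] at h1
    simpa [φ] using h1.symm
  refine ⟨_, hn, doubling_injective ?_⟩
  rw [h, map_zpow, doubling_of, ← zpow_natCast, ← zpow_mul]
  exact congrArg _ hn

end Doubling

/-! ### Two half-lines glued into one, compatibly with doubling -/

section Line

/-- A set on which the free group with generators `c'`, `c''` (indexed by `false` and `true`) acts
freely on the left; the orbits are indexed by the letters `a', b', a'', b''` (and two unused
ones). -/
abbrev FreeOrbits : Type := (FLetter × Bool) × FreeGroup Bool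

/-- The sequence of points formed by one half of the `c''`-line through `b''` and one half of the
`c'`-line through `b'`. -/
def line (i : ℤ) : FreeOrbits :=
  if i ≤ 0 then ((.b, true), FreeGroup.of true ^ (-i)) else ((.b, false), FreeGroup.of false ^ (-i))

theorem line_of_nonpos {i : ℤ} (h : i ≤ 0) : line i = ((.b, true), FreeGroup.of true ^ (-i)) :=
  if_pos h

theorem line_of_pos {i : ℤ} (h : 0 < i) : line i = ((.b, false), FreeGroup.of false ^ (-i)) :=
  if_neg (not_le.2 h)

theorem of_zpow_injective {α : Type*} (x : α) :
    Function.Injective fun n : ℤ => FreeGroup.of x ^ n := by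
  classical
  intro m n h
  have := congrArg (FreeGroup.lift fun _ : α => Multiplicative.ofAdd (1 : ℤ)) h
  simpa using congrArg Multiplicative.toAdd this

theorem line_injective : Function.Injective line := by
  intro i j h
  rcases le_or_gt i 0 with hi | hi <;> rcases le_or_gt j 0 with hj | hj
  · rw [line_of_nonpos hi, line_of_nonpos hj] at h
    exact neg_injective (of_zpow_injective _ (Prod.ext_iff.1 h).2)
  · rw [line_of_nonpos hi, line_of_pos hj] at h
    simp at h
  · rw [line_of_pos hi, line_of_nonpos hj] at h
    simp at h
  · rw [line_of_pos hi, line_of_pos hj] at h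
    exact neg_injective (of_zpow_injective _ (Prod.ext_iff.1 h).2)

/-- The permutation moving `line i` to `line (i - 1)` and fixing all points off the line. -/
noncomputable def lineShift : Equiv.Perm FreeOrbits :=
  Equiv.Perm.viaEmbedding (Equiv.subRight (1 : ℤ)) ⟨line, line_injective⟩

theorem lineShift_line (i : ℤ) : lineShift (line i) = line (i - 1) :=
  Equiv.Perm.viaEmbedding_apply (Equiv.subRight (1 : ℤ)) ⟨line, line_injective⟩ i

theorem lineShift_of_notMem {z : FreeOrbits} (h : z ∉ Set.range line) : lineShift z = z :=
  Equiv.Perm.viaEmbedding_apply_of_notMem (Equiv.subRight (1 : ℤ)) ⟨line, line_injective⟩ z h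

/-- Left multiplication. -/
def leftPerm : FreeGroup Bool →* Equiv.Perm FreeOrbits where
  toFun v := Equiv.prodCongrRight fun _ => Equiv.mulLeft v
  map_one' := Equiv.ext fun z => Prod.ext rfl (one_mul z.2)
  map_mul' v v' := Equiv.ext fun z => Prod.ext rfl (mul_assoc v v' z.2)

@[simp] theorem leftPerm_apply (v v' : FreeGroup Bool) (k : FLetter × Bool) :
    leftPerm v (k, v') = (k, v * v') := rfl

/-- The action of the free group generated by `c` (indexed by `none`), `c'` and `c''`. -/
noncomputable def orbitPerm : FreeGroup (Option Bool) →* Equiv.Perm FreeOrbits :=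
  FreeGroup.lift fun
  | none => lineShift
  | some x => leftPerm (FreeGroup.of x)

theorem orbitPerm_map_some (v : FreeGroup Bool) :
    orbitPerm (FreeGroup.map some v) = leftPerm v := by
  have : orbitPerm.comp (FreeGroup.map some) = leftPerm := by
    ext x : 1
    simp [orbitPerm]
  exact DFunLike.congr_fun this v

/-- The maps of points corresponding to `b_i ↦ b_{2 * i - n}`. -/
def double (n : ℤ) (z : FreeOrbits) : FreeOrbits :=
  (z.1, doubling Bool z.2 * FreeGroup.of z.1.2 ^ n)

theorem double_injective (n : ℤ) : Function.Injective (double n) := by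
  rintro ⟨k, v⟩ ⟨k', v'⟩ h
  simp only [double, Prod.mk.injEq] at h
  obtain ⟨rfl, h⟩ := h
  rw [doubling_injective (mul_right_cancel h)]

/-- The bounds on `n` keep each half `i ≤ 0` and `i > 0` invariant under `i ↦ 2i - n`, so the
doubling maps respect the gluing. The value `0` serves `t`, the value `1` serves `s`. -/
theorem double_line {n : ℤ} (h0 : 0 ≤ n) (h1 : n ≤ 1) (i : ℤ) :
    double n (line i) = line (2 * i - n) := by
  rcases le_or_gt i 0 with hi | hi
  · rw [line_of_nonpos hi, line_of_nonpos (by omega)]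
    simp only [double, map_zpow, doubling_of, ← zpow_natCast, ← zpow_mul, ← zpow_add]
    congr 2
    push_cast
    ring
  · rw [line_of_pos hi, line_of_pos (by omega)]
    simp only [double, map_zpow, doubling_of, ← zpow_natCast, ← zpow_mul, ← zpow_add]
    congr 2
    push_cast
    ring

/-- Off the line the glued shift is the identity; it is compatible with doubling there only because
no outside point is doubled onto the line. -/
theorem mem_range_of_double_mem {n : ℤ} (h0 : 0 ≤ n) (h1 : n ≤ 1) {z : FreeOrbits}
    (h : double n z ∈ Set.range line) : z ∈ Set.range line := by
  obtain ⟨⟨k, x⟩, v⟩ := z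
  obtain ⟨j, hj⟩ := h
  have key : ∀ y, (k, x) = (FLetter.b, y) → FreeGroup.of y ^ (-j) =
      doubling Bool v * FreeGroup.of x ^ n →
      ∃ m : ℤ, j = 2 * m - n ∧ v = FreeGroup.of y ^ (-m) := by
    rintro y hy h
    obtain ⟨rfl, rfl⟩ := Prod.mk.inj hy
    rw [← mul_inv_eq_iff_eq_mul, ← zpow_neg, ← zpow_add] at h
    obtain ⟨m, hm, hv⟩ := eq_zpow_of_doubling_eq h.symm
    exact ⟨-m, by omega, by rw [neg_neg, hv]⟩
  rcases le_or_gt j 0 with h | h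
  · rw [line_of_nonpos h] at hj
    obtain ⟨hk, hv⟩ := Prod.mk.inj hj
    obtain ⟨m, hm, hv⟩ := key _ hk.symm hv
    refine ⟨m, ?_⟩
    rw [line_of_nonpos (by omega), hv]
    exact congrArg (·, _) hk
  · rw [line_of_pos h] at hj
    obtain ⟨hk, hv⟩ := Prod.mk.inj hj
    obtain ⟨m, hm, hv⟩ := key _ hk.symm hv
    refine ⟨m, ?_⟩
    rw [line_of_pos (by omega), hv]
    exact congrArg (·, _) hk

theorem double_lineShift {n : ℤ} (h0 : 0 ≤ n) (h1 : n ≤ 1) (z : FreeOrbits) :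
    double n (lineShift z) = lineShift (lineShift (double n z)) := by
  by_cases h : z ∈ Set.range line
  · obtain ⟨i, rfl⟩ := h
    rw [lineShift_line, double_line h0 h1, double_line h0 h1, lineShift_line, lineShift_line]
    congr 1
    ring
  · have h' : double n z ∉ Set.range line := fun h' => h (mem_range_of_double_mem h0 h1 h')
    rw [lineShift_of_notMem h, lineShift_of_notMem h', lineShift_of_notMem h']

theorem double_orbitPerm {n : ℤ} (h0 : 0 ≤ n) (h1 : n ≤ 1) (g : FreeGroup (Option Bool))
    (z : FreeOrbits) :
    double n (orbitPerm g z) = orbitPerm (doubling _ g) (double n z) := by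
  have hof : ∀ (x : Option Bool) (z : FreeOrbits), double n (orbitPerm (FreeGroup.of x) z) =
      orbitPerm (doubling _ (FreeGroup.of x)) (double n z) := by
    rintro (_ | x) z
    · simpa [orbitPerm, pow_two] using double_lineShift h0 h1 z
    · obtain ⟨k, v⟩ := z
      simp [orbitPerm, pow_two, double, mul_assoc]
  induction g using FreeGroup.induction_on generalizing z with
  | C1 => simp
  | of x => exact hof x z
  | inv_of x _ =>
    rw [map_inv, map_inv, map_inv, Equiv.Perm.eq_inv_iff_eq, ← hof, ← Equiv.Perm.mul_apply,
      mul_inv_cancel, Equiv.Perm.one_apply]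
  | mul x y hx hy => simp only [map_mul, Equiv.Perm.mul_apply, hx, hy]

/-- The split extension by `⟨c, c', c''⟩` of the free group on the points of `FreeOrbits`. -/
abbrev LineGroup : Type :=
  FreeGroup FreeOrbits ⋊[(permAut FreeOrbits).comp orbitPerm] FreeGroup (Option Bool)

/-- The endomorphism of `LineGroup` that squares `c, c', c''` and maps points by `double n`. -/
noncomputable def lineEnd {n : ℤ} (h0 : 0 ≤ n) (h1 : n ≤ 1) : LineGroup →* LineGroup :=
  SemidirectProduct.map (FreeGroup.map (double n)) (doubling _) fun g => by
    ext z
    simp [double_orbitPerm h0 h1]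

theorem lineEnd_injective {n : ℤ} (h0 : 0 ≤ n) (h1 : n ≤ 1) :
    Function.Injective (lineEnd h0 h1) := by
  intro x y h
  refine SemidirectProduct.ext ?_ ?_
  · exact FreeGroup.map_injective (double_injective n) (congrArg SemidirectProduct.left h)
  · exact doubling_injective (congrArg SemidirectProduct.right h)

/-- The elements `a', b', c', a'', b'', c''` of a split extension. -/
def sixElements {H : Type*} [Group H] (φ : H →* Equiv.Perm FreeOrbits) (c : Bool → H)
    (p : FLetter × Bool) : FreeGroup FreeOrbits ⋊[(permAut FreeOrbits).comp φ] H :=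
  if p.1 = .c then SemidirectProduct.inr (c p.2) else SemidirectProduct.inl (FreeGroup.of (p, 1))

/-- Without `c`, the point `(k, v)` can be read as the conjugate `v k v⁻¹`. This retracts the split
extension onto the free group on the six letters. Adding `c` only enlarges the acting group. -/
theorem sixElements_injective : Function.Injective
    (FreeGroup.lift (sixElements orbitPerm fun x => FreeGroup.of (some x))) := by
  let f₀ := FreeGroup.lift (sixElements leftPerm FreeGroup.of)
  let cc : FreeGroup Bool →* FreeGroup (FLetter × Bool) :=
    FreeGroup.lift fun x => FreeGroup.of (.c, x)
  let r : FreeGroup FreeOrbits ⋊[(permAut FreeOrbits).comp leftPerm] FreeGroup Bool →*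
      FreeGroup (FLetter × Bool) :=
    SemidirectProduct.lift (FreeGroup.lift fun z => cc z.2 * FreeGroup.of z.1 * (cc z.2)⁻¹) cc
      fun v => by
        ext ⟨k, v'⟩
        simp [mul_assoc]
  have hr : r.comp f₀ = MonoidHom.id _ := by
    ext ⟨k, x⟩
    by_cases h : k = .c
    · simp [r, f₀, sixElements, h, cc]
    · simp [r, f₀, sixElements, h]
  have hf₀ : Function.Injective f₀ := by
    intro x y h
    have := congrArg r h
    rwa [← MonoidHom.comp_apply, ← MonoidHom.comp_apply, hr] at this
  let m : FreeGroup FreeOrbits ⋊[(permAut FreeOrbits).comp leftPerm] FreeGroup Bool →* LineGroup :=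
    SemidirectProduct.map (MonoidHom.id _) (FreeGroup.map some) fun v => by
      ext z
      simp [orbitPerm_map_some]
  have hm : Function.Injective m := by
    intro x y h
    refine SemidirectProduct.ext ?_ ?_
    · have h' : (m x).left = (m y).left := congrArg SemidirectProduct.left h
      simpa [m] using h'
    · exact FreeGroup.map_injective (Option.some_injective _) (congrArg SemidirectProduct.right h)
  have hcomp : FreeGroup.lift (sixElements orbitPerm fun x => FreeGroup.of (some x)) =
      m.comp f₀ := by
    ext ⟨k, x⟩ : 1
    by_cases h : k = .c
    · simp [m, f₀, sixElements, h]
    · simp [m, f₀, sixElements, h]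
  rw [hcomp]
  exact hm.comp hf₀

end Line

/-- A group containing a free group on `a', b', c', a'', b'', c''`, written `x (k, i)`, and elements
`c, t, s` such that the triples `b', c'` and `b'', c''` and `b'', c` satisfy the same relations with
`t, s`, and `b'' ^ c = b' ^ c'`. -/
theorem exists_three_lines : ∃ (Q : Type) (_ : Group Q) (x : FLetter × Bool → Q) (c t s : Q),
    Function.Injective (FreeGroup.lift x) ∧
    (∀ i, cj (x (.b, i)) t = x (.b, i)) ∧
    (∀ i, cj (x (.b, i)) s = cj (x (.b, i)) (x (.c, i))⁻¹) ∧
    (∀ i, cj (x (.c, i)) t = x (.c, i) ^ 2) ∧ (∀ i, cj (x (.c, i)) s = x (.c, i) ^ 2) ∧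
    cj c t = c ^ 2 ∧ cj c s = c ^ 2 ∧ cj (x (.b, true)) s = cj (x (.b, true)) c⁻¹ ∧
    cj (x (.b, true)) c = cj (x (.b, false)) (x (.c, false)) := by
  -- The injective endomorphisms for `n = 0` and `n = 1` become conjugations by `t` and `s`.
  obtain ⟨Q₁, _, ι₁, t, hι₁, ht⟩ := exists_conjugating (MonoidHom.id LineGroup)
    (lineEnd le_rfl zero_le_one) Function.injective_id (lineEnd_injective le_rfl zero_le_one)
  obtain ⟨Q, _, ι₂, s, hι₂, hs⟩ := exists_conjugating ι₁
    (ι₁.comp (lineEnd zero_le_one le_rfl)) hι₁ (hι₁.comp (lineEnd_injective zero_le_one le_rfl))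
  let y := sixElements orbitPerm fun x => FreeGroup.of (some x)
  let ι := ι₂.comp ι₁
  have hι : Function.Injective ι := hι₂.comp hι₁
  have ht' : ∀ z, cj (ι z) (ι₂ t) = ι (lineEnd le_rfl zero_le_one z) := by
    intro z
    have := congrArg ι₂ (ht z)
    rwa [map_cj] at this
  have hs' : ∀ z, cj (ι z) s = ι (lineEnd zero_le_one le_rfl z) := hs
  have hyb : ∀ i, y (.b, i) = SemidirectProduct.inl (FreeGroup.of ((.b, i), 1)) := fun i => rfl
  have hyc : ∀ i, y (.c, i) = SemidirectProduct.inr (FreeGroup.of (some i)) := fun i => rfl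
  have h0 : line 0 = ((.b, true), 1) := by simp [line_of_nonpos]
  refine ⟨Q, inferInstance, fun p => ι (y p), ι (SemidirectProduct.inr (FreeGroup.of none)), ι₂ t,
    s, ?_, fun i => ?_, fun i => ?_, fun i => ?_, fun i => ?_, ?_, ?_, ?_, ?_⟩
  · have : (FreeGroup.lift fun p => ι (y p)) = ι.comp (FreeGroup.lift y) := by
      ext p : 1
      simp
    rw [this]
    exact hι.comp sixElements_injective
  · simp only [hyb]
    rw [ht']
    simp [lineEnd, double]
  · simp only [hyb, hyc]
    rw [hs', ← map_inv, ← map_cj, ← map_inv, cj_inl_of_inr]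
    rw [lineEnd, SemidirectProduct.map_inl]
    simp [double, orbitPerm]
  · simp only [hyc]
    rw [ht']
    simp [lineEnd]
  · simp only [hyc]
    rw [hs']
    simp [lineEnd]
  · rw [ht']
    simp [lineEnd]
  · rw [hs']
    simp [lineEnd]
  · simp only [hyb]
    rw [hs', ← map_inv, ← map_cj, ← map_inv, cj_inl_of_inr, ← h0]
    simp only [lineEnd, SemidirectProduct.map_inl, FreeGroup.map.of, map_inv, inv_inv]
    rw [double_line zero_le_one le_rfl]
    simp [orbitPerm, lineShift_line]
  · simp only [hyb, hyc]
    rw [← map_cj, ← map_cj, cj_inl_of_inr, cj_inl_of_inr, ← h0]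
    congr 3
    -- The seam of the line is between `0` and `1`: `c` takes `b''` to the point with index `1`,
    -- which is `b' ^ c'`.
    have h1 : orbitPerm (FreeGroup.of none) (line 1) = line 0 := by
      simp [orbitPerm, lineShift_line]
    rw [Equiv.Perm.inv_eq_iff_eq.2 h1.symm, line_of_pos one_pos]
    simp [orbitPerm, ← map_inv]

/-- A group with elements satisfying the relations of `𝒜` without `d` and `e`, in which
`a ^ u₁, b ^ u₁, c ^ u₁, a ^ u₂, b ^ u₂, c ^ u₂` generate freely. -/
theorem exists_base : ∃ (Γ : Type) (_ : Group Γ) (x : FLetter → Γ) (t s u₁ u₂ : Γ),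
    (cj (x .b) t = x .b ∧ cj (x .b) s = cj (x .b) (x .c)⁻¹ ∧ cj (x .c) t = x .c ^ 2 ∧
      cj (x .c) s = x .c ^ 2) ∧
    (cj (cj (x .b) (x .c)) u₁ = cj (x .b) (x .c) ∧ cj t u₁ = t ∧ cj s u₁ = s) ∧
    (cj (x .a) u₂ = x .a ∧ cj (x .b) u₂ = x .b ∧ cj t u₂ = t ∧ cj s u₂ = s) ∧
    Function.Injective
      (FreeGroup.lift fun p : FLetter × Bool => cj (x p.1) (if p.2 then u₂ else u₁)) := by
  obtain ⟨Q, _, x, c, t, s, hx, hbt, hbs, hct, hcs, hct', hcs', hbs', hbc⟩ := exists_three_lines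
  -- The extra factor `Q` holds a copy of coordinate 1 of `G`; `u₁` and `u₂` exchange it for a copy
  -- of coordinate 2 or 3. They fix elements whose relevant coordinates agree, while the extra
  -- coordinate of `x ^ u₁` and `x ^ u₂` shows the free letters with one and two primes.
  let G := Q × Q × Q
  let ρ₀ : G →* Q × G := (MonoidHom.fst Q (Q × Q)).prod (MonoidHom.id G)
  let ρ₁ : G →* Q × G :=
    ((MonoidHom.fst Q Q).comp (MonoidHom.snd Q (Q × Q))).prod (MonoidHom.id G)
  let ρ₂ : G →* Q × G :=
    ((MonoidHom.snd Q Q).comp (MonoidHom.snd Q (Q × Q))).prod (MonoidHom.id G)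
  have inj : ∀ f : G →* Q, Function.Injective (f.prod (MonoidHom.id G)) :=
    fun f y z h => (Prod.ext_iff.1 h).2
  obtain ⟨Γ₁, _, ι₁, u₁, hι₁, hu₁⟩ := exists_conjugating ρ₀ ρ₁ (inj _) (inj _)
  obtain ⟨Γ₂, _, ι₂, u₂, hι₂, hu₂⟩ := exists_conjugating (ι₁.comp ρ₀) (ι₁.comp ρ₂)
    (hι₁.comp (inj _)) (hι₁.comp (inj _))
  -- `a` and `b` agree in coordinates 1 and 3, hence are fixed by `u₂`. The glued shift in
  -- coordinate 1 of `c` makes `b ^ c` agree in coordinates 1 and 2, as `u₁` requires.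
  let y : FLetter → G := fun
    | .a => (x (.a, true), x (.a, false), x (.a, true))
    | .b => (x (.b, true), x (.b, false), x (.b, true))
    | .c => (c, x (.c, false), x (.c, true))
  let ι := ι₂.comp ι₁
  let ρ := ι.comp ρ₀
  have hu₁' : ∀ g, cj (ρ g) (ι₂ u₁) = ι (ρ₁ g) := by
    intro g
    have := congrArg ι₂ (hu₁ g)
    rwa [map_cj] at this
  have hu₂' : ∀ g, cj (ρ g) u₂ = ι (ρ₂ g) := hu₂
  have e₁ : ∀ g : G, g.1 = g.2.1 → cj (ρ g) (ι₂ u₁) = ρ g := by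
    intro g hg
    rw [hu₁']
    exact congrArg ι (Prod.ext hg.symm rfl)
  have e₂ : ∀ g : G, g.1 = g.2.2 → cj (ρ g) u₂ = ρ g := by
    intro g hg
    rw [hu₂']
    exact congrArg ι (Prod.ext hg.symm rfl)
  refine ⟨Γ₂, inferInstance, fun k => ρ (y k), ρ (t, t, t), ρ (s, s, s), ι₂ u₁, u₂,
    ⟨?_, ?_, ?_, ?_⟩, ⟨?_, ?_, ?_⟩, ⟨?_, ?_, ?_, ?_⟩, ?_⟩
  · rw [← map_cj]
    exact congrArg ρ (Prod.ext (hbt true) (Prod.ext (hbt false) (hbt true)))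
  · rw [← map_inv, ← map_cj, ← map_cj]
    exact congrArg ρ (Prod.ext hbs' (Prod.ext (hbs false) (hbs true)))
  · rw [← map_pow, ← map_cj]
    exact congrArg ρ (Prod.ext hct' (Prod.ext (hct false) (hct true)))
  · rw [← map_pow, ← map_cj]
    exact congrArg ρ (Prod.ext hcs' (Prod.ext (hcs false) (hcs true)))
  · rw [← map_cj]
    exact e₁ _ hbc
  · exact e₁ _ rfl
  · exact e₁ _ rfl
  · exact e₂ _ rfl
  · exact e₂ _ rfl
  · exact e₂ _ rfl
  · exact e₂ _ rfl
  · let z : FLetter × Bool → Q × G := fun p => if p.2 then ρ₂ (y p.1) else ρ₁ (y p.1)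
    have h1 : (FreeGroup.lift fun p : FLetter × Bool =>
        cj (ρ (y p.1)) (if p.2 then u₂ else ι₂ u₁)) = ι.comp (FreeGroup.lift z) := by
      ext ⟨k, _ | _⟩ : 1
      · simp [z, hu₁']
      · simp [z, hu₂']
    have h2 : (MonoidHom.fst Q G).comp (FreeGroup.lift z) = FreeGroup.lift x := by
      ext ⟨k, _ | _⟩ : 1 <;> cases k <;> simp [z, y, ρ₁, ρ₂] <;> rfl
    rw [h1]
    refine (hι₂.comp hι₁).comp (Function.Injective.of_comp (f := MonoidHom.fst Q G) ?_)
    rw [← MonoidHom.coe_comp, h2]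
    exact hx

/-! ### A group satisfying the relations of `𝒜` -/

/-- An automorphism of a subgroup is induced by a permutation of the group fixing `1`. -/
theorem exists_perm_of_mulAut {Γ K : Type*} [Group Γ] [Group K] (j : K →* Γ)
    (hj : Function.Injective j) (δ : MulAut K) :
    ∃ d : Equiv.Perm Γ, d 1 = 1 ∧ ∀ k, cj (MulAction.toPermHom Γ Γ (j k)) d =
      MulAction.toPermHom Γ Γ (j (δ k)) := by
  -- A transversal containing `1` splits `Γ` as `j(K) × T`; the automorphism acts on the first
  -- factor.
  obtain ⟨T, hT, h1⟩ := j.range.exists_isComplement_right 1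
  let δ' : j.range ≃* j.range :=
    (MonoidHom.ofInjective hj).symm.trans (δ.trans (MonoidHom.ofInjective hj))
  let D : Equiv.Perm Γ := hT.equiv.trans ((δ'.toEquiv.prodCongr (Equiv.refl T)).trans hT.equiv.symm)
  have hDe : ∀ x, hT.equiv (D x) = (δ' (hT.equiv x).1, (hT.equiv x).2) := by
    intro x
    exact hT.equiv.apply_symm_apply _
  have hDj : ∀ (h : j.range) (x : Γ), D (h * x) = δ' h * D x := by
    intro h x
    apply hT.equiv.injective
    rw [hDe, hT.equiv_mul_left, hT.equiv_mul_left, hDe, map_mul]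
  have hD1 : D 1 = 1 := by
    apply hT.equiv.injective
    rw [hDe, hT.equiv_one (one_mem _) h1]
    exact congrArg (·, _) (map_one δ')
  have hδ' : ∀ k, δ' (MonoidHom.ofInjective hj k) = MonoidHom.ofInjective hj (δ k) := by
    intro k
    simp [δ']
  refine ⟨D⁻¹, ?_, fun k => ?_⟩
  · rw [Equiv.Perm.inv_eq_iff_eq, hD1]
  · rw [cj, inv_inv, mul_inv_eq_iff_eq_mul]
    refine Equiv.ext fun x => ?_
    have := hDj (MonoidHom.ofInjective hj k) x
    rw [hδ'] at this
    exact this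

/-- The reflection `f ↦ f(-·)` of functions. -/
def reflection : E ≃+ E := Finsupp.domCongr (Equiv.neg ℤ)

theorem reflection_apply (f : E) (i : ℤ) : reflection f i = f (-i) := by
  simp [reflection, Finsupp.domCongr, Finsupp.equivMapDomain_apply]

theorem rho_eq_image (X : Set E) : rho X = reflection '' X := by
  ext f
  constructor
  · rintro ⟨g, hg, h⟩
    exact ⟨g, hg, Finsupp.ext fun i => by rw [reflection_apply, h]⟩
  · rintro ⟨g, hg, rfl⟩
    exact ⟨g, hg, reflection_apply g⟩

theorem reflection_single : reflection (Finsupp.single 0 1) = Finsupp.single 0 1 := by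
  simp [reflection, Finsupp.domCongr]

/-- This is why `ē` is paired with `e⁻¹` in the relation for `v₁`. -/
theorem shift_reflection_shift (f : E) : shift (reflection (shift f)) = reflection f := by
  ext i
  simp only [shift_apply, reflection_apply]
  congr 1
  ring

/-- There is a group with elements satisfying the relations of `𝒜` such that `a, b, c` generate
freely and, in the square of the group, an element `(x, y)` of `F × F` generated by
`(a, a), (d, d), (e⁻¹, e)` has `x` in `A_{ρX}` if it has `y` in `A_X`. -/
theorem exists_model : ∃ (A : Type) (_ : Group A) (g : ALetter → A), SatisfiesA g ∧
    Function.Injective (ofA g) ∧ ∀ (X : Set E) (x y : F),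
      (ofA g x, ofA g y) ∈
        Subgroup.closure {(g .a, g .a), (g .d, g .d), ((g .e)⁻¹, g .e)} →
      y ∈ subgroupA X → x ∈ subgroupA (rho X) := by
  obtain ⟨Γ, _, x, t, s, u₁, u₂, ⟨h1, h2, h3, h4⟩, ⟨h5, h6, h7⟩, ⟨h8, h9, h10, h11⟩, hinj⟩ :=
    exists_base
  let j : FreeGroup (FLetter × Bool) →* Γ :=
    FreeGroup.lift fun p : FLetter × Bool => cj (x p.1) (if p.2 then u₂ else u₁)
  let i : F →* Γ := FreeGroup.lift x
  have hi : Function.Injective i := by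
    have : (cjHom u₁).comp i = j.comp (FreeGroup.map fun k => (k, false)) := by
      ext k
      simp [i, j, cjHom_apply]
    refine Function.Injective.of_comp (f := cjHom u₁) ?_
    rw [← MonoidHom.coe_comp, this]
    exact hinj.comp (FreeGroup.map_injective fun k k' h => (Prod.mk.inj h).1)
  -- As required of `d`, the generators `x ^ u₁` are fixed and the `x ^ u₂` are conjugated by `b ^
  -- u₂`.
  let twist (z : FreeGroup (FLetter × Bool)) :
      FreeGroup (FLetter × Bool) →* FreeGroup (FLetter × Bool) :=
    FreeGroup.lift fun p => if p.2 then cj (FreeGroup.of p) z else FreeGroup.of p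
  have htwist : ∀ n m : ℤ, n + m = 0 → (twist (FreeGroup.of (.b, true) ^ n)).comp
      (twist (FreeGroup.of (.b, true) ^ m)) = MonoidHom.id _ := by
    intro n m hnm
    have hb : twist (FreeGroup.of (.b, true) ^ n) (FreeGroup.of (.b, true)) =
        FreeGroup.of (.b, true) := by
      simp only [twist, FreeGroup.lift_apply_of, if_true]
      exact cj_eq_of_commute (Commute.self_zpow _ _)
    ext ⟨k, _ | _⟩ : 1
    · simp [twist]
    · rw [MonoidHom.comp_apply]
      conv_lhs => rw [show twist (FreeGroup.of (.b, true) ^ m) (FreeGroup.of (k, true)) =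
        cj (FreeGroup.of (k, true)) (FreeGroup.of (.b, true) ^ m) by simp [twist]]
      rw [map_cj, map_zpow, hb]
      simp only [twist, FreeGroup.lift_apply_of, if_true]
      rw [← cj_mul_right, ← zpow_add, hnm, zpow_zero, cj_one, MonoidHom.id_apply]
  let δ : MulAut (FreeGroup (FLetter × Bool)) :=
    MonoidHom.toMulEquiv _ _ (htwist (-1) 1 (by norm_num)) (htwist 1 (-1) (by norm_num))
  have hδ : ∀ p, δ (FreeGroup.of p) =
      if p.2 then cj (FreeGroup.of p) (FreeGroup.of (.b, true)) else FreeGroup.of p := by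
    intro p
    simp [δ, twist]
  let push (n : ℤ) : F →* F := FreeGroup.lift fun
    | .a => FreeGroup.of .a
    | .b => cj (FreeGroup.of .b) (FreeGroup.of .c ^ n)
    | .c => FreeGroup.of .c
  have hpush : ∀ n m : ℤ, n + m = 0 → (push n).comp (push m) = MonoidHom.id _ := by
    intro n m hnm
    ext k
    cases k <;> simp [push, map_cj, ← cj_mul_right, ← zpow_add, hnm, cj_one]
  let ε : MulAut F :=
    MonoidHom.toMulEquiv _ _ (hpush (-1) 1 (by norm_num)) (hpush 1 (-1) (by norm_num))
  obtain ⟨d, hd1, hd⟩ := exists_perm_of_mulAut j hinj δ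
  obtain ⟨e, he1, he⟩ := exists_perm_of_mulAut i hi ε
  obtain ⟨L, hLdef⟩ : ∃ L : Γ →* Equiv.Perm Γ, L = MulAction.toPermHom Γ Γ := ⟨_, rfl⟩
  have hLapp : ∀ y z, L y z = y * z := by
    intro y z
    rw [hLdef]
    rfl
  rw [← hLdef] at hd he
  let g : ALetter → Equiv.Perm Γ := fun
    | .a => L (x .a)
    | .b => L (x .b)
    | .c => L (x .c)
    | .t => L t
    | .s => L s
    | .u₁ => L u₁
    | .u₂ => L u₂
    | .d => d
    | .e => e
  have hd₁ : ∀ k, cj (cj (L (x k)) (L u₁)) d = cj (L (x k)) (L u₁) := by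
    intro k
    have := hd (FreeGroup.of (k, false))
    rw [hδ] at this
    simpa [j, map_cj] using this
  have hd₂ : ∀ k, cj (cj (L (x k)) (L u₂)) d = cj (L (x k)) (L (x .b) * L u₂) := by
    intro k
    have := hd (FreeGroup.of (k, true))
    rw [hδ] at this
    simp only [j, FreeGroup.lift_apply_of, if_true, map_cj] at this
    rw [this, cj_mul_right]
    simp [cj, mul_assoc]
  have hg : SatisfiesA g :=
    { t_b := by simp only [g, ← map_cj, h1]
      s_b := by simp only [g, ← map_cj, ← map_inv, h2]
      t_c := by simp only [g, ← map_cj, ← map_pow, h3]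
      s_c := by simp only [g, ← map_cj, ← map_pow, h4]
      u₁_b := by simp only [g, ← map_cj, h5]
      u₁_t := by simp only [g, ← map_cj, h6]
      u₁_s := by simp only [g, ← map_cj, h7]
      u₂_a := by simp only [g, ← map_cj, h8]
      u₂_b := by simp only [g, ← map_cj, h9]
      u₂_t := by simp only [g, ← map_cj, h10]
      u₂_s := by simp only [g, ← map_cj, h11]
      d_a₁ := hd₁ .a
      d_b₁ := hd₁ .b
      d_c₁ := hd₁ .c
      d_a₂ := hd₂ .a
      d_b₂ := by
        refine (hd₂ .b).trans ?_
        rw [cj_mul_right, cj_eq_of_commute (Commute.refl _)]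
      d_c₂ := hd₂ .c
      e_a := by simpa [i, ε, push] using he (FreeGroup.of .a)
      e_b := by simpa [i, ε, push, map_cj] using he (FreeGroup.of .b)
      e_c := by simpa [i, ε, push] using he (FreeGroup.of .c) }
  have hL : ofA g = L.comp i := by
    ext k : 1
    cases k <;> simp [i, g]
  have hL1 : ∀ z, ofA g z 1 = i z := by
    intro z
    rw [hL]
    rw [MonoidHom.comp_apply, hLapp, mul_one]
  -- The points `P w` form a copy of the free group on `E` inside the set `Γ`. As `d` and `e` fix
  -- `1`, their conjugation action on the `a_f` becomes an action on these points.
  let P : FreeGroup E → Γ := fun w => i (freeA w)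
  have hP : Function.Injective P := hi.comp freeA_injective
  have hconj : ∀ (y : Equiv.Perm Γ) (π : E → E), y 1 = 1 →
      (∀ f, cj (ofA g (aF f)) y = ofA g (aF (π f))) →
      ∀ w, y⁻¹ (P w) = P (FreeGroup.map π w) := by
    intro y π hy1 hy w
    have h : (cjHom y).comp ((ofA g).comp freeA) =
        ((ofA g).comp freeA).comp (FreeGroup.map π) := by
      ext f : 1
      simp [cjHom_apply, hy]
    have hw := DFunLike.congr_fun (DFunLike.congr_fun h w) 1
    simp only [MonoidHom.comp_apply, cjHom_apply, hL1] at hw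
    simpa [cj, hy1, hL1] using hw
  refine ⟨Equiv.Perm Γ, inferInstance, g, hg, ?_, ?_⟩
  · intro y z h
    apply hi
    rw [← hL1, ← hL1, h]
  · intro X y z hyz hz
    let R : FreeGroup E →* FreeGroup E := FreeGroup.map reflection
    -- Pairs whose two entries move the points by one and the same permutation `σ` of words, read
    -- through the reflection in the first entry; `σ` need not be an automorphism.
    let M : Subgroup (Equiv.Perm Γ × Equiv.Perm Γ) :=
      { carrier := {q | ∃ σ : Equiv.Perm (FreeGroup E), ∀ w,
          q.2 (P w) = P (σ w) ∧ q.1 (P (R w)) = P (R (σ w))}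
        one_mem' := ⟨1, fun w => ⟨rfl, rfl⟩⟩
        mul_mem' := by
          rintro q q' ⟨σ, hσ⟩ ⟨σ', hσ'⟩
          refine ⟨σ * σ', fun w => ⟨?_, ?_⟩⟩
          · rw [Prod.snd_mul, Equiv.Perm.mul_apply, (hσ' w).1, (hσ _).1, Equiv.Perm.mul_apply]
          · rw [Prod.fst_mul, Equiv.Perm.mul_apply, (hσ' w).2, (hσ _).2, Equiv.Perm.mul_apply]
        inv_mem' := by
          rintro q ⟨σ, hσ⟩
          refine ⟨σ⁻¹, fun w => ⟨?_, ?_⟩⟩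
          · rw [Prod.snd_inv, Equiv.Perm.inv_eq_iff_eq, (hσ _).1, ← Equiv.Perm.mul_apply,
              mul_inv_cancel, Equiv.Perm.one_apply]
          · rw [Prod.fst_inv, Equiv.Perm.inv_eq_iff_eq, (hσ _).2, ← Equiv.Perm.mul_apply,
              mul_inv_cancel, Equiv.Perm.one_apply] }
    have hRmap : ∀ (π π' : E → E), (∀ f, reflection (π f) = π' (reflection f)) →
        ∀ w, R (FreeGroup.map π w) = FreeGroup.map π' (R w) := by
      intro π π' h w
      have : R.comp (FreeGroup.map π) = (FreeGroup.map π').comp R := by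
        ext f : 1
        simp [R, h]
      exact DFunLike.congr_fun this w
    have hM : Subgroup.closure {(g .a, g .a), (g .d, g .d), ((g .e)⁻¹, g .e)} ≤ M := by
      rw [Subgroup.closure_le]
      rintro q (rfl | rfl | rfl)
      · have ha : ∀ w, g .a (P w) = P (FreeGroup.of 0 * w) := by
          intro w
          change L (x .a) (P w) = _
          rw [hLapp]
          simp [P, i, aF_zero]
        refine ⟨Equiv.mulLeft (FreeGroup.of 0), fun w => ⟨ha w, ?_⟩⟩
        rw [ha, Equiv.coe_mulLeft, map_mul]
        simp [R]
      -- It is the inverse of `d` that moves points by `f ↦ f + δ₀`, so the inverse pair is tested;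
      -- likewise for `e`.
      · have h' := hconj d (· + Finsupp.single 0 1) hd1 hg.cj_aF_d
        refine inv_mem_iff.1
          ⟨(FreeGroup.freeGroupCongr (Equiv.addRight (Finsupp.single 0 1))).toEquiv,
            fun w => ⟨h' w, ?_⟩⟩
        rw [Prod.fst_inv, h' (R w)]
        exact congrArg P (hRmap _ _ (fun f => by
          rw [Equiv.coe_addRight, map_add, reflection_single]) w).symm
      · have h' := hconj e shift he1 hg.cj_aF_e
        refine inv_mem_iff.1
          ⟨(FreeGroup.freeGroupCongr shift.toEquiv).toEquiv, fun w => ⟨h' w, ?_⟩⟩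
        rw [Prod.fst_inv, inv_inv, ← Equiv.Perm.eq_inv_iff_eq]
        refine Eq.trans ?_ (h' _).symm
        have : (FreeGroup.map shift).comp (R.comp (FreeGroup.map shift)) = R := by
          ext f : 1
          simp [R, shift_reflection_shift]
        exact congrArg P (DFunLike.congr_fun this w).symm
    obtain ⟨σ, hσ⟩ := hM hyz
    rw [← map_freeA_closure] at hz
    obtain ⟨w, hw, rfl⟩ := hz
    -- At the trivial word, the second entry gives `σ 1 = w`, and the first then equals the
    -- reflected word.
    have h1' := (hσ 1).1
    have h2' := (hσ 1).2
    simp only [P, map_one, hL1] at h1' h2'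
    rw [← hP h1'] at h2'
    rw [hi h2', ← map_freeA_closure, rho_eq_image]
    refine ⟨_, ?_, rfl⟩
    have := Subgroup.mem_map_of_mem R hw
    rw [MonoidHom.map_closure, Set.image_image] at this
    simpa [R, Set.image_image] using this

/-! ### The relations of `K_{ρX}` -/

section RelationsRho

variable {r : ℕ} {G : Type*} [Group G]

theorem forall_freeGroup_mem {α : Type*} (f : FreeGroup α →* G) (K : Subgroup G)
    (h : ∀ x, f (FreeGroup.of x) ∈ K) (y : FreeGroup α) : f y ∈ K := by
  induction y using FreeGroup.induction_on with
  | C1 => simp [K.one_mem]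
  | of x => exact h x
  | inv_of x hx => rw [map_inv]; exact K.inv_mem hx
  | mul x y hx hy => rw [map_mul]; exact K.mul_mem hx hy

theorem commute_freeGroup {α : Type*} (f : FreeGroup α →* G) (z : G)
    (h : ∀ x, Commute (f (FreeGroup.of x)) z) (y : FreeGroup α) : Commute (f y) z := by
  have := forall_freeGroup_mem f (fixedBy z)
    (fun x => mem_fixedBy.2 (cj_eq_of_commute (h x))) y
  exact commute_of_cj_eq (mem_fixedBy.1 this)

theorem mem_fLetters (x : FLetter) : x ∈ fLetters := by cases x <;> simp [fLetters]

theorem mem_aLetters (x : ALetter) : x ∈ aLetters := by cases x <;> simp [aLetters]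

/-- The homomorphism `φ` respects the relations of `K_{ρX}`. -/
structure SatisfiesRho (R S : List (FreeGroup (FLetter ⊕ Fin r)))
    (φ : FreeGroup (KLetter r) →* G) : Prop where
  plain : SatisfiesA fun x => φ (pl x)
  bar : SatisfiesA fun x => φ (br x)
  rel : ∀ y ∈ R, φ (barWord y) = 1
  comm : ∀ x y, Commute (φ (pl x)) (φ (br y))
  comm_extra : ∀ x i, Commute (φ (pl x)) (φ (.of (.extra i)))
  v₁_a : cj (φ (br .a) * φ (pl .a)) (φ (.of .v₁)) = φ (br .a) * φ (pl .a)
  v₁_d : cj (φ (br .d) * φ (pl .d)) (φ (.of .v₁)) = φ (br .d) * φ (pl .d)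
  v₁_e : cj (φ (br .e) * (φ (pl .e))⁻¹) (φ (.of .v₁)) = φ (br .e) * (φ (pl .e))⁻¹
  v₂_S : ∀ s ∈ S, cj (φ (barWord s)) (φ (.of .v₂)) = φ (barWord s)
  v₂_a : cj (φ (pl .a)) (φ (.of .v₂)) = φ (pl .a)
  v₂_d : cj (φ (pl .d)) (φ (.of .v₂)) = φ (pl .d)
  v₂_e : cj (φ (pl .e)) (φ (.of .v₂)) = φ (pl .e)
  w₁_bar : ∀ x : FLetter, cj (φ (br x.toA)) (φ (.of .w₁)) = φ (br x.toA)
  w₂_plain : ∀ x, cj (cj (φ (pl x)) (φ (.of .v₁) * φ (.of .v₂))) (φ (.of .w₂)) =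
    cj (φ (pl x)) (φ (.of .v₁) * φ (.of .v₂))
  w₂_bar : ∀ x, cj (cj (φ (br x)) (φ (.of .v₁) * φ (.of .v₂))) (φ (.of .w₂)) =
    cj (φ (br x)) (φ (.of .v₁) * φ (.of .v₂))
  w₃_plain : ∀ x : FLetter, cj (φ (pl x.toA)) (φ (.of .w₃)) = φ (pl x.toA)
  w₄_w₁ : ∀ y ∈ sixWords, cj (cj (φ y) (φ (.of .w₁))) (φ (.of .w₄)) = cj (φ y) (φ (.of .w₁))
  w₄_w₂ : ∀ y ∈ sixWords, cj (cj (φ y) (φ (.of .w₂))) (φ (.of .w₄)) = cj (φ y) (φ (.of .w₂))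

theorem forall_map_relatorsA {H : Type*} [Group H] (φ : H →* G) (g : ALetter → H) :
    (∀ y ∈ relatorsA g, φ y = 1) ↔ SatisfiesA fun x => φ (g x) := by
  rw [satisfiesA_iff, ← map_relatorsA, List.forall_mem_map]

theorem forall_fLetters {P : FLetter → Prop} : (∀ x, P x) ↔ P .a ∧ P .b ∧ P .c :=
  ⟨fun h => ⟨h _, h _, h _⟩, fun h x => by cases x; exacts [h.1, h.2.1, h.2.2]⟩

theorem satisfiesRho_iff (R S : List (FreeGroup (FLetter ⊕ Fin r)))
    (φ : FreeGroup (KLetter r) →* G) :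
    SatisfiesRho R S φ ↔ ∀ y ∈ relatorsRho R S, φ y = 1 := by
  simp only [relatorsRho, List.forall_mem_append, forall_map_relatorsA, List.forall_mem_map,
    List.forall_mem_flatMap, List.forall_mem_cons, List.not_mem_nil, false_imp_iff, implies_true,
    and_true, map_fixes, map_commutes, map_mul, map_inv, map_cj, fixes_eq_one, commutes_eq_one,
    mem_aLetters, true_imp_iff, List.mem_finRange]
  constructor
  · rintro ⟨h1, h2, h3, h4, h5, h6, h7, h8, h9, h10, h11, h12, h13, h14, h15, h16, h17, h18⟩
    rw [forall_fLetters] at h13 h16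
    exact ⟨⟨⟨⟨⟨⟨⟨⟨⟨⟨⟨⟨⟨h1, h2⟩, h3⟩, h4⟩, h5⟩, h6, h7, h8⟩, h9⟩, h10, h11, h12⟩, h13⟩, h14⟩, h15⟩,
      h16⟩, h17⟩, h18⟩
  · rintro ⟨⟨⟨⟨⟨⟨⟨⟨⟨⟨⟨⟨⟨h1, h2⟩, h3⟩, h4⟩, h5⟩, h6, h7, h8⟩, h9⟩, h10, h11, h12⟩, h13⟩, h14⟩, h15⟩,
      h16⟩, h17⟩, h18⟩
    exact ⟨h1, h2, h3, h4, h5, h6, h7, h8, h9, h10, h11, h12, forall_fLetters.2 h13, h14, h15,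
      forall_fLetters.2 h16, h17, h18⟩

theorem pl_mem_sixWords (x : FLetter) : (pl x.toA : FreeGroup (KLetter r)) ∈ sixWords :=
  List.mem_append_left _ (List.mem_map_of_mem (mem_fLetters x))

theorem forall_sixWords {P : FreeGroup (KLetter r) → Prop} :
    (∀ y ∈ sixWords, P y) ↔ (∀ x : FLetter, P (pl x.toA)) ∧ ∀ x : FLetter, P (br x.toA) := by
  simp [sixWords, or_imp, forall_and, mem_fLetters]

namespace SatisfiesRho

variable {R S : List (FreeGroup (FLetter ⊕ Fin r))} {φ : FreeGroup (KLetter r) →* G}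

/-- If the barred copy of `a_g` lies in the barred copy of `L_X`, then `a_f` with `f(i) = g(-i)`
lies in `L_{ρX}`. -/
theorem aF_mem (h : SatisfiesRho R S φ) (g : E)
    (hg : ofA (fun x => φ (br x)) (aF g) ∈ Subgroup.closure {y | ∃ s ∈ S, y = φ (barWord s)}) :
    ofA (fun x => φ (pl x)) (aF (reflection g)) ∈
      Subgroup.closure {y | ∃ s ∈ generatorsRho (r := r), y = φ s} := by
  set p := ofA fun x => φ (pl x) with hp
  set q := ofA fun x => φ (br x) with hq
  have hpof : ∀ x, p (FreeGroup.of x) = φ (pl x.toA) := fun x => by simp [hp, ofA]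
  have hqof : ∀ x, q (FreeGroup.of x) = φ (br x.toA) := fun x => by simp [hq, ofA]
  have hpc : ∀ x y, Commute (p x) (φ (br y)) := fun x y =>
    commute_freeGroup p _ (fun z => by rw [hpof]; exact h.comm _ _) x
  have hqc : ∀ x y, Commute (q x) (φ (pl y)) := fun x y =>
    commute_freeGroup q _ (fun z => by rw [hqof]; exact (h.comm _ _).symm) x
  have hmem : ∀ {v z y : G}, y ∈ fixedBy v → (z ∈ fixedBy v ↔ cj z y ∈ fixedBy v) := by
    intro v z y hy
    rw [cj, Subgroup.mul_mem_cancel_right _ hy,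
      Subgroup.mul_mem_cancel_left _ (Subgroup.inv_mem _ hy)]
  -- Conjugation by `d̄d` and `ēe⁻¹` acts separately on the two commuting factors.
  have hv₁ : ∀ f, q (aF f) * p (aF (reflection f)) ∈ fixedBy (φ (.of .v₁)) := by
    refine E_induction ?_ (fun f => ?_) (fun f => ?_)
    · rw [map_zero, aF_zero, hpof, hqof]
      exact mem_fixedBy.2 h.v₁_a
    · rw [hmem (mem_fixedBy.2 h.v₁_d)]
      have h1 : cj (q (aF f)) (φ (br .d)) = q (aF (f + Finsupp.single 0 1)) := h.bar.cj_aF_d f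
      have h2 : cj (p (aF (reflection f))) (φ (pl .d)) =
          p (aF (reflection (f + Finsupp.single 0 1))) := by
        rw [map_add, reflection_single]
        exact h.plain.cj_aF_d _
      rw [← cjHom_apply, map_mul, cjHom_apply, cjHom_apply, cj_mul_right, cj_mul_right, h1,
        cj_eq_of_commute (hqc _ _), cj_eq_of_commute (hpc _ _), h2]
    · rw [hmem (mem_fixedBy.2 h.v₁_e)]
      have h1 : cj (q (aF f)) (φ (br .e)) = q (aF (shift f)) := h.bar.cj_aF_e f
      have h2 : cj (p (aF (reflection f))) (φ (pl .e))⁻¹ = p (aF (reflection (shift f))) := by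
        refine cj_inv_right_eq ?_
        rw [← shift_reflection_shift f]
        exact h.plain.cj_aF_e _
      rw [← cjHom_apply, map_mul, cjHom_apply, cjHom_apply, cj_mul_right, cj_mul_right, h1,
        cj_eq_of_commute (hqc _ _).inv_right, cj_eq_of_commute (hpc _ _), h2]
  have hv₂p : ∀ f, p (aF f) ∈ fixedBy (φ (.of .v₂)) := by
    refine E_induction ?_ (fun f => ?_) (fun f => ?_)
    · rw [aF_zero, hpof]
      exact mem_fixedBy.2 h.v₂_a
    · rw [hmem (mem_fixedBy.2 h.v₂_d)]
      exact iff_of_eq (congrArg (· ∈ _) (h.plain.cj_aF_d f))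
    · rw [hmem (mem_fixedBy.2 h.v₂_e)]
      exact iff_of_eq (congrArg (· ∈ _) (h.plain.cj_aF_e f))
  have hv₂q : q (aF g) ∈ fixedBy (φ (.of .v₂)) := by
    refine (Subgroup.closure_le _).2 ?_ hg
    rintro _ ⟨s, hs, rfl⟩
    exact mem_fixedBy.2 (h.v₂_S s hs)
  set y := q (aF g) * p (aF (reflection g)) with hy
  have hyv : cj y (φ (.of .v₁) * φ (.of .v₂)) = y := by
    rw [cj_mul_right, mem_fixedBy.1 (hv₁ g)]
    exact mem_fixedBy.1 (Subgroup.mul_mem _ hv₂q (hv₂p _))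
  have key : ∀ v w : G, (∀ x : FLetter, cj (cj (φ (pl x.toA)) v) w = cj (φ (pl x.toA)) v) →
      (∀ x : FLetter, cj (cj (φ (br x.toA)) v) w = cj (φ (br x.toA)) v) → ∀ x x' : F,
      cj (q x * p x') v ∈ fixedBy w := by
    intro v w h1 h2 x x'
    rw [← cjHom_apply, map_mul]
    refine Subgroup.mul_mem _ ?_ ?_
    · refine forall_freeGroup_mem ((cjHom v).comp q) _ (fun z => ?_) x
      rw [MonoidHom.comp_apply, hqof, cjHom_apply]
      exact mem_fixedBy.2 (h2 z)
    · refine forall_freeGroup_mem ((cjHom v).comp p) _ (fun z => ?_) x'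
      rw [MonoidHom.comp_apply, hpof, cjHom_apply]
      exact mem_fixedBy.2 (h1 z)
  have hw₂ : cj y (φ (.of .w₂)) = y := by
    have := key _ _ (fun x => h.w₂_plain x.toA) (fun x => h.w₂_bar x.toA) (aF g)
      (aF (reflection g))
    rw [← hy, hyv] at this
    exact mem_fixedBy.1 this
  have hw₁ : cj (q (aF g)) (φ (.of .w₁)) = q (aF g) := by
    refine mem_fixedBy.1 (forall_freeGroup_mem q _ (fun z => ?_) _)
    rw [hqof]
    exact mem_fixedBy.2 (h.w₁_bar z)
  have hw₃ : cj (p (aF (reflection g))) (φ (.of .w₃)) = p (aF (reflection g)) := by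
    refine mem_fixedBy.1 (forall_freeGroup_mem p _ (fun z => ?_) _)
    rw [hpof]
    exact mem_fixedBy.2 (h.w₃_plain z)
  have hw₄y : y ∈ fixedBy (φ (.of .w₄)) := by
    have h4 := forall_sixWords.1 h.w₄_w₂
    have := key _ _ h4.1 h4.2 (aF g) (aF (reflection g))
    rwa [← hy, hw₂] at this
  have hw₄q : q (aF g) ∈ fixedBy (φ (.of .w₄)) := by
    have h4 := forall_sixWords.1 h.w₄_w₁
    have := key _ _ h4.1 h4.2 (aF g) 1
    rwa [map_one, mul_one, hw₁] at this
  have hw₄ : cj (p (aF (reflection g))) (φ (.of .w₄)) = p (aF (reflection g)) :=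
    mem_fixedBy.1 ((Subgroup.mul_mem_cancel_left _ hw₄q).1 hw₄y)
  have hfin : cj (p (aF (reflection g))) (φ (.of .w₃) * φ (.of .w₄)) = p (aF (reflection g)) := by
    rw [cj_mul_right, hw₃, hw₄]
  rw [← hfin, ← cjHom_apply, ← MonoidHom.comp_apply]
  refine forall_freeGroup_mem _ _ (fun z => ?_) _
  rw [MonoidHom.comp_apply, hpof, cjHom_apply]
  refine Subgroup.subset_closure ⟨_, List.mem_map_of_mem (pl_mem_sixWords z), ?_⟩
  rw [map_cj, map_mul]

end SatisfiesRho

end RelationsRho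

/-! ### A group satisfying the relations of `K_{ρX}` -/

/-- Groups with a common subgroup embed in one group, so that they agree on the subgroup. -/
theorem exists_amalgam {H A B : Type} [Group H] [iA : Group A] [iB : Group B] (f : H →* A)
    (g : H →* B)
    (hf : Function.Injective f) (hg : Function.Injective g) :
    ∃ (P : Type) (_ : Group P) (α : A →* P) (β : B →* P),
      Function.Injective α ∧ Function.Injective β ∧ ∀ h, α (f h) = β (g h) := by
  let G : Bool → Type := fun i => bif i then A else B
  let inst : ∀ i, Group (G i) := fun
    | true => iA
    | false => iB
  let φ : ∀ i, H →* G i := fun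
    | true => f
    | false => g
  have hφ : ∀ i, Function.Injective (φ i) := fun
    | true => hf
    | false => hg
  refine ⟨Monoid.PushoutI φ, inferInstance, Monoid.PushoutI.of (φ := φ) true,
    Monoid.PushoutI.of (φ := φ) false, Monoid.PushoutI.of_injective hφ true,
    Monoid.PushoutI.of_injective hφ false, fun h => ?_⟩
  exact (Monoid.PushoutI.of_apply_eq_base φ true h).trans
    (Monoid.PushoutI.of_apply_eq_base φ false h).symm

/-- A homomorphism of the free group that respects the relators factors through the presented
group. -/
theorem exists_presentedHom {β : Type} {G : Type*} [Group G] {R : List (FreeGroup β)}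
    (φ : FreeGroup β →* G) (h : ∀ y ∈ R, φ y = 1) :
    ∃ Φ : Presented R →* G, ∀ y, Φ (PresentedGroup.mk _ y) = φ y :=
  ⟨QuotientGroup.lift _ φ (Subgroup.normalClosure_le_normal (N := φ.ker) h), fun _ => rfl⟩

/-- The relations of `K_{ρX}` hold in a group in which `a, b, c` generate freely a subgroup that
meets `L_{ρX}` in a subgroup of `A_{ρX}`. -/
theorem exists_rho_model {r : ℕ} (R S : List (FreeGroup (FLetter ⊕ Fin r))) (X : Set E)
    (h : IsExplicitPair R S (fun x => FreeGroup.of (Sum.inl x)) (subgroupA X)) :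
    ∃ (Ω : Type) (_ : Group Ω) (φ : FreeGroup (KLetter r) →* Ω), SatisfiesRho R S φ ∧
      Function.Injective (ofA fun x => φ (pl x)) ∧
      ∀ z : F, ofA (fun x => φ (pl x)) z ∈
        Subgroup.closure {y | ∃ s ∈ generatorsRho (r := r), y = φ s} → z ∈ subgroupA (rho X) := by
  obtain ⟨A, _, g, hg, hgi, hsep⟩ := exists_model
  obtain ⟨hφ, hL⟩ := h
  -- The barred letters live in `P`, where the model of 𝒜 and `K_X` share the subgroup `F`.
  obtain ⟨P, _, α, β, hα, hβ, hαβ⟩ := exists_amalgam (ofA g) _ hgi hφ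
  let Fp : Subgroup (A × P) := (ofA g).range.prod ⊥
  let Fb : Subgroup (A × P) := (⊥ : Subgroup A).prod (α.comp (ofA g)).range
  let FF : Subgroup (A × P) := (ofA g).range.prod (α.comp (ofA g)).range
  let AA : Subgroup (A × P) := (⊤ : Subgroup A).prod α.range
  let B : Subgroup (A × P) := ((subgroupA (rho X)).map (ofA g)).prod (α.comp (ofA g)).range
  let δ : A × A →* A × P := (MonoidHom.id A).prodMap α
  have hδ : Function.Injective δ := by
    rintro ⟨x, y⟩ ⟨x', y'⟩ h
    obtain ⟨h1, h2⟩ := Prod.mk.inj h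
    exact Prod.ext h1 (hα h2)
  let M : Subgroup (A × P) :=
    (Subgroup.closure {(g .a, g .a), (g .d, g .d), ((g .e)⁻¹, g .e)}).map δ
  let N : Subgroup (A × P) := (⊤ : Subgroup A).prod ((wordSubgroup R S).map β)
  obtain ⟨Γ₁, _, ι₁, v₁, hι₁, hv₁, hv₁'⟩ := exists_centralizing M
  obtain ⟨Γ₂, _, ι₂, v₂, hι₂, hv₂, hv₂'⟩ := exists_centralizing (N.map ι₁)
  let κ : A × P →* Γ₂ := ι₂.comp ι₁
  have hκ : Function.Injective κ := hι₂.comp hι₁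
  let D : Subgroup Γ₂ := (AA.map κ).map (cjHom (ι₂ v₁ * v₂))
  -- If `z ^ (v₁v₂) = y` within `A × P`, the strong form of centralizing, used for `v₂` and then for
  -- `v₁`, gives `z = y` in both `M` and `N`.
  have hDM : ∀ y : A × P, κ y ∈ D → y ∈ M ∧ y ∈ N := by
    rintro y ⟨_, ⟨z, hz, rfl⟩, hzy⟩
    rw [cjHom_apply, cj_mul_right] at hzy
    have h1 : cj (ι₂ (cj (ι₁ z) v₁)) v₂ = ι₂ (ι₁ y) := by
      rw [map_cj]
      exact hzy
    obtain ⟨h2, h3⟩ := hv₂' _ _ h1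
    obtain ⟨h4, rfl⟩ := hv₁' _ _ h3
    rw [h3] at h2
    exact ⟨h4, (Subgroup.mem_map_iff_mem hι₁).1 h2⟩
  have hBF : B ≤ FF := Subgroup.prod_mono (Subgroup.map_le_range _ _) le_rfl
  have hFbB : Fb ≤ B := Subgroup.prod_mono bot_le le_rfl
  -- Membership in `N` and `F ∩ L_X = A_X` put the second coordinate in `A_X`; membership in `M`
  -- then puts the first in `A_{ρX}`.
  have hDB : D ⊓ FF.map κ ≤ B.map κ := by
    rintro _ ⟨hyD, ⟨y, hy, rfl⟩⟩
    refine Subgroup.mem_map_of_mem κ ?_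
    obtain ⟨hyM, hyN⟩ := hDM y hyD
    obtain ⟨y₁, y₂⟩ := y
    obtain ⟨⟨x, hx⟩, ⟨x', hx'⟩⟩ := Subgroup.mem_prod.1 hy
    simp only at hx hx'
    subst hx hx'
    refine Subgroup.mem_prod.2 ⟨Subgroup.mem_map_of_mem _ ?_, ⟨x', rfl⟩⟩
    refine hsep X x x' ((Subgroup.mem_map_iff_mem hδ).1 hyM) ?_
    rw [← hL]
    have h1 := (Subgroup.mem_prod.1 hyN).2
    simp only [MonoidHom.comp_apply, hαβ] at h1
    exact (Subgroup.mem_map_iff_mem hβ).1 h1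
  obtain ⟨Γ₃, _, ι₃, w₁, w₂, J, hι₃, hw₁, hw₂, hJ₁, hJ₂, hJ⟩ :=
    exists_centralizing_pair (FF.map κ) (B.map κ) (Fb.map κ) D (Subgroup.map_mono hBF)
      (inf_le_left.trans (Subgroup.map_mono hFbB)) hDB
  obtain ⟨Γ₄, _, ι₄, w₃, hι₄, hw₃, hw₃'⟩ := exists_centralizing ((Fp.map κ).map ι₃)
  obtain ⟨Γ₅, _, ι₅, w₄, hι₅, hw₄, hw₄'⟩ := exists_centralizing (J.map ι₄)
  let k : KLetter r → Γ₅ := fun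
    | .plain x => ι₅ (ι₄ (ι₃ (κ (g x, 1))))
    | .bar x => ι₅ (ι₄ (ι₃ (κ (1, α (g x)))))
    | .extra i => ι₅ (ι₄ (ι₃ (κ (1, β (PresentedGroup.of (Sum.inr i))))))
    | .v₁ => ι₅ (ι₄ (ι₃ (ι₂ v₁)))
    | .v₂ => ι₅ (ι₄ (ι₃ v₂))
    | .w₁ => ι₅ (ι₄ w₁)
    | .w₂ => ι₅ (ι₄ w₂)
    | .w₃ => ι₅ w₃
    | .w₄ => w₄
  let φ : FreeGroup (KLetter r) →* Γ₅ := FreeGroup.lift k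
  have hof : ∀ x, φ (.of x) = k x := fun x => FreeGroup.lift_apply_of
  let τ : A × P →* Γ₅ := ι₅.comp (ι₄.comp (ι₃.comp κ))
  have hτ : Function.Injective τ := hι₅.comp (hι₄.comp (hι₃.comp hκ))
  have hpl : ∀ x, φ (pl x) = τ (g x, 1) := fun x => hof _
  have hbr : ∀ x, φ (br x) = τ (1, α (g x)) := fun x => hof _
  have hplF : ∀ z, ofA (fun x => φ (pl x)) z = τ (ofA g z, 1) := by
    intro z
    have : ofA (fun x => φ (pl x)) = τ.comp ((MonoidHom.inl A P).comp (ofA g)) := by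
      ext x
      simp only [MonoidHom.comp_apply, ofA, FreeGroup.lift_apply_of, hpl, MonoidHom.inl_apply]
    exact DFunLike.congr_fun this z
  have hword : ∀ s, φ (barWord s) = τ (1, β (PresentedGroup.mk _ s)) := by
    intro s
    have : φ.comp barWord =
        τ.comp ((MonoidHom.inr A P).comp (β.comp (PresentedGroup.mk {y | y ∈ R}))) := by
      ext x : 1
      rcases x with x | i
      · have hx := hαβ (FreeGroup.of x)
        simp only [ofA, letterHom, FreeGroup.lift_apply_of] at hx
        simp only [MonoidHom.comp_apply, barWord, FreeGroup.map.of, barLetter,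
          MonoidHom.inr_apply, ← hx]
        exact hbr _
      · simp only [MonoidHom.comp_apply, barWord, FreeGroup.map.of, barLetter,
          MonoidHom.inr_apply]
        exact hof _
    exact DFunLike.congr_fun this s
  have hv₁k : ∀ y, cj (τ y) (φ (.of .v₁)) = ι₅ (ι₄ (ι₃ (ι₂ (cj (ι₁ y) v₁)))) := by
    intro y
    simp only [map_cj]
    rw [hof]
    rfl
  have hv₂k : ∀ y, cj (τ y) (φ (.of .v₂)) = ι₅ (ι₄ (ι₃ (cj (κ y) v₂))) := by
    intro y
    simp only [map_cj]
    rw [hof]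
    rfl
  have hv₁M : ∀ y ∈ M, cj (τ y) (φ (.of .v₁)) = τ y := by
    intro y hy
    rw [hv₁k, hv₁ y hy]
    rfl
  have hv₂N : ∀ y ∈ N, cj (τ y) (φ (.of .v₂)) = τ y := by
    intro y hy
    rw [hv₂k]
    exact congrArg (fun y => ι₅ (ι₄ (ι₃ y))) (hv₂ _ (Subgroup.mem_map_of_mem ι₁ hy))
  have hw₁F : ∀ y ∈ Fb, cj (τ y) (φ (.of .w₁)) = τ y := by
    intro y hy
    rw [hof]
    have := congrArg (fun y => ι₅ (ι₄ y)) (hw₁ _ (Subgroup.mem_map_of_mem κ hy))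
    simp only [map_cj] at this
    exact this
  have hw₂D : ∀ y ∈ AA, cj (cj (τ y) (φ (.of .v₁) * φ (.of .v₂))) (φ (.of .w₂)) =
      cj (τ y) (φ (.of .v₁) * φ (.of .v₂)) := by
    intro y hy
    rw [hof, hof, hof]
    have := congrArg (fun y => ι₅ (ι₄ y)) (hw₂ _ (Subgroup.mem_map_of_mem (cjHom (ι₂ v₁ * v₂))
      (Subgroup.mem_map_of_mem κ hy)))
    simp only [map_cj, cjHom_apply, map_mul] at this
    exact this
  have hw₃F : ∀ y ∈ Fp, cj (τ y) (φ (.of .w₃)) = τ y := by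
    intro y hy
    rw [hof]
    have := congrArg ι₅
      (hw₃ _ (Subgroup.mem_map_of_mem ι₃ (Subgroup.mem_map_of_mem κ hy)))
    simp only [map_cj] at this
    exact this
  have hw₄w : ∀ (y : A × P) (w : Γ₃), cj (ι₃ (κ y)) w ∈ J →
      cj (cj (τ y) (ι₅ (ι₄ w))) (φ (.of .w₄)) = cj (τ y) (ι₅ (ι₄ w)) := by
    intro y w hy
    rw [hof]
    have := hw₄ _ (Subgroup.mem_map_of_mem ι₄ hy)
    simp only [map_cj] at this
    exact this
  have hsix : ∀ y ∈ sixWords (r := r), ∃ z ∈ FF, φ y = τ z := by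
    refine forall_sixWords.2 ⟨fun x => ⟨_, ?_, hpl _⟩, fun x => ⟨_, ?_, hbr _⟩⟩
    · exact Subgroup.mem_prod.2 ⟨⟨FreeGroup.of x, by simp [ofA]⟩, one_mem _⟩
    · exact Subgroup.mem_prod.2 ⟨one_mem _, ⟨FreeGroup.of x, by simp [ofA]⟩⟩
  have hMgen : ∀ y ∈ ({(g .a, g .a), (g .d, g .d), ((g .e)⁻¹, g .e)} : Set (A × A)), δ y ∈ M :=
    fun y hy => Subgroup.mem_map_of_mem δ (Subgroup.subset_closure hy)
  have hcomm : ∀ (y : A) (z : P), Commute (τ (y, 1)) (τ (1, z)) := fun y z =>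
    (show Commute (y, (1 : P)) ((1 : A), z) from Prod.ext (by simp) (by simp)).map τ
  have hbp : ∀ y z : A, τ (1, α z) * τ (y, 1) = τ (δ (y, z)) := by
    intro y z
    rw [← map_mul, Prod.mk_mul_mk, one_mul, mul_one]
    rfl
  refine ⟨Γ₅, inferInstance, φ, ?_, ?_, ?_⟩
  · exact
    { plain := by
        simp only [hpl]
        exact hg.map (τ.comp (MonoidHom.inl A P))
      bar := by
        simp only [hbr]
        exact hg.map (τ.comp ((MonoidHom.inr A P).comp α))
      rel := by
        intro y hy
        rw [hword, PresentedGroup.one_of_mem hy, map_one]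
        exact map_one τ
      comm := by
        intro x y
        rw [hpl, hbr]
        exact hcomm _ _
      comm_extra := by
        intro x i
        rw [hpl, hof]
        exact hcomm _ _
      v₁_a := by
        rw [hpl, hbr, hbp]
        exact hv₁M _ (hMgen _ (by simp))
      v₁_d := by
        rw [hpl, hbr, hbp]
        exact hv₁M _ (hMgen _ (by simp))
      v₁_e := by
        rw [hpl, hbr, ← map_inv, Prod.inv_mk, inv_one, hbp]
        exact hv₁M _ (hMgen _ (by simp))
      v₂_S := by
        intro s hs
        rw [hword]
        exact hv₂N _ (Subgroup.mem_prod.2 ⟨trivial, Subgroup.mem_map_of_mem β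
          (Subgroup.subset_closure ⟨s, hs, rfl⟩)⟩)
      v₂_a := by
        rw [hpl]
        exact hv₂N _ (Subgroup.mem_prod.2 ⟨trivial, one_mem _⟩)
      v₂_d := by
        rw [hpl]
        exact hv₂N _ (Subgroup.mem_prod.2 ⟨trivial, one_mem _⟩)
      v₂_e := by
        rw [hpl]
        exact hv₂N _ (Subgroup.mem_prod.2 ⟨trivial, one_mem _⟩)
      w₁_bar := by
        intro x
        rw [hbr]
        exact hw₁F _ (Subgroup.mem_prod.2 ⟨one_mem _, ⟨FreeGroup.of x, by simp [ofA]⟩⟩)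
      w₂_plain := by
        intro x
        rw [hpl]
        exact hw₂D _ (Subgroup.mem_prod.2 ⟨trivial, one_mem _⟩)
      w₂_bar := by
        intro x
        rw [hbr]
        exact hw₂D _ (Subgroup.mem_prod.2 ⟨trivial, ⟨_, rfl⟩⟩)
      w₃_plain := by
        intro x
        rw [hpl]
        exact hw₃F _ (Subgroup.mem_prod.2 ⟨⟨FreeGroup.of x, by simp [ofA]⟩, one_mem _⟩)
      w₄_w₁ := by
        intro y hy
        obtain ⟨z, hz, hyz⟩ := hsix y hy
        rw [hyz, hof .w₁]
        exact hw₄w _ _ (hJ₁ _ (Subgroup.mem_map_of_mem κ hz))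
      w₄_w₂ := by
        intro y hy
        obtain ⟨z, hz, hyz⟩ := hsix y hy
        rw [hyz, hof .w₂]
        exact hw₄w _ _ (hJ₂ _ (Subgroup.mem_map_of_mem κ hz)) }
  · intro y z hyz
    rw [hplF, hplF] at hyz
    exact hgi (Prod.mk.inj (hτ hyz)).1
  · intro z hz
    have hle : Subgroup.closure {y | ∃ s ∈ generatorsRho (r := r), y = φ s} ≤
        (FF.map τ).map (cjHom (ι₅ w₃ * w₄)) := by
      rw [Subgroup.closure_le]
      rintro _ ⟨s, hs, rfl⟩
      obtain ⟨y, hy, rfl⟩ := List.mem_map.1 hs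
      obtain ⟨x, hx, hyx⟩ := hsix y hy
      rw [map_cj, map_mul, hof, hof, hyx, ← cjHom_apply]
      exact Subgroup.mem_map_of_mem _ (Subgroup.mem_map_of_mem τ hx)
    obtain ⟨_, ⟨y, hy, rfl⟩, hyz⟩ := hle hz
    rw [hplF, cjHom_apply, cj_mul_right] at hyz
    -- The conjugate of `y` by `w₃w₄` lies in the group without `w₄`, so `y ^ w₃` lies in `J`. It
    -- equals the given element of `F`, and `J` meets `Γ₂` inside `B`.
    have h1 : cj (ι₅ (cj (ι₄ (ι₃ (κ y))) w₃)) w₄ = ι₅ (ι₄ (ι₃ (κ (ofA g z, 1)))) := by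
      rw [map_cj]
      exact hyz
    obtain ⟨h2, h3⟩ := hw₄' _ _ h1
    rw [h3] at h2
    have h4 := hJ _ ((Subgroup.mem_map_iff_mem hι₄).1 h2)
    have h5 := (Subgroup.mem_prod.1 ((Subgroup.mem_map_iff_mem hκ).1 h4)).1
    exact (Subgroup.mem_map_iff_mem hgi).1 h5

/-- Freeness and `F ∩ L ≤ A_{ρX}` are pulled back from the model, as membership in `L` survives
homomorphisms. The reverse inclusion holds in the presented group itself by `aF_mem`, where `K_X` is
mapped to the barred letters. -/
theorem isExplicitPair_rho {r : ℕ} (R S : List (FreeGroup (FLetter ⊕ Fin r))) (X : Set E)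
    (h : IsExplicitPair R S (fun x => FreeGroup.of (Sum.inl x)) (subgroupA X)) :
    IsExplicitPair (relatorsRho R S) generatorsRho lettersRho (subgroupA (rho X)) := by
  obtain ⟨Ω, _, φ, hφ, hinj, hΩ⟩ := exists_rho_model R S X h
  obtain ⟨Φ, hΦ⟩ := exists_presentedHom φ ((satisfiesRho_iff R S φ).1 hφ)
  let mk : FreeGroup (KLetter r) →* Presented (relatorsRho R S) := PresentedGroup.mk _
  have hmk : SatisfiesRho R S mk :=
    (satisfiesRho_iff R S mk).2 fun y hy => PresentedGroup.one_of_mem hy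
  have hΦF : ∀ z, Φ (letterHom (relatorsRho R S) lettersRho z) = ofA (fun x => φ (pl x)) z := by
    intro z
    have : Φ.comp (letterHom (relatorsRho R S) lettersRho) = ofA (fun x => φ (pl x)) := by
      ext x : 1
      simp only [MonoidHom.comp_apply, letterHom, ofA, FreeGroup.lift_apply_of, hΦ, lettersRho]
    exact DFunLike.congr_fun this z
  refine ⟨fun y z hyz => hinj ?_, le_antisymm (fun z hz => hΩ z ?_) ?_⟩
  · rw [← hΦF, ← hΦF, hyz]
  · rw [← hΦF]
    have := Subgroup.mem_map_of_mem Φ (Subgroup.mem_comap.1 hz)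
    rw [wordSubgroup, MonoidHom.map_closure] at this
    refine Subgroup.closure_mono ?_ this
    rintro _ ⟨_, ⟨s, hs, rfl⟩, rfl⟩
    exact ⟨s, hs, hΦ s⟩
  · rw [subgroupA, Subgroup.closure_le]
    rintro _ ⟨f, hf, rfl⟩
    rw [rho_eq_image] at hf
    obtain ⟨g, hg, rfl⟩ := hf
    refine hmk.aF_mem g ?_
    obtain ⟨ψ, hψ⟩ := exists_presentedHom (mk.comp barWord) hmk.rel
    have hψF :
        ofA (fun x => mk (br x)) = ψ.comp (letterHom R fun x => FreeGroup.of (Sum.inl x)) := by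
      ext x : 1
      simp only [MonoidHom.comp_apply, letterHom, ofA, FreeGroup.lift_apply_of, hψ]
      simp [barWord, barLetter, br]
    have hgX : aF g ∈ subgroupA X := Subgroup.subset_closure ⟨g, hg, rfl⟩
    rw [← h.2] at hgX
    have := Subgroup.mem_map_of_mem ψ (Subgroup.mem_comap.1 hgX)
    rw [wordSubgroup, MonoidHom.map_closure] at this
    rw [hψF, MonoidHom.comp_apply]
    refine Subgroup.closure_mono ?_ this
    rintro _ ⟨_, ⟨s, hs, rfl⟩, rfl⟩
    exact ⟨s, hs, hψ s⟩

/-! ### Numbers of generators and relations -/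

instance : Fintype ALetter := ⟨aLetters.toFinset, fun x => List.mem_toFinset.2 (mem_aLetters x)⟩

instance : Fintype FLetter := ⟨fLetters.toFinset, fun x => List.mem_toFinset.2 (mem_fLetters x)⟩

/-- The generators of `K_{ρX}` in four groups. -/
def kLetterEquiv (r : ℕ) : KLetter r ≃ (ALetter ⊕ ALetter) ⊕ (Fin r ⊕ Fin 6) where
  toFun
    | .plain x => .inl (.inl x)
    | .bar x => .inl (.inr x)
    | .extra i => .inr (.inl i)
    | .v₁ => .inr (.inr 0)
    | .v₂ => .inr (.inr 1)
    | .w₁ => .inr (.inr 2)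
    | .w₂ => .inr (.inr 3)
    | .w₃ => .inr (.inr 4)
    | .w₄ => .inr (.inr 5)
  invFun
    | .inl (.inl x) => .plain x
    | .inl (.inr x) => .bar x
    | .inr (.inl i) => .extra i
    | .inr (.inr 0) => .v₁
    | .inr (.inr 1) => .v₂
    | .inr (.inr 2) => .w₁
    | .inr (.inr 3) => .w₂
    | .inr (.inr 4) => .w₃
    | .inr (.inr 5) => .w₄
  left_inv x := by cases x <;> rfl
  right_inv x := by
    rcases x with (x | x) | (i | i)
    · rfl
    · rfl
    · rfl
    · fin_cases i <;> rfl

instance (r : ℕ) : Finite (KLetter r) := Finite.of_equiv _ (kLetterEquiv r).symm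

theorem card_kLetter (r : ℕ) : Nat.card (KLetter r) = r + 24 := by
  have hA : Fintype.card ALetter = 9 := rfl
  rw [Nat.card_congr (kLetterEquiv r)]
  simp [hA]
  ring

theorem card_generators (r : ℕ) : Nat.card (FLetter ⊕ Fin r) = r + 3 := by
  have hF : Fintype.card FLetter = 3 := rfl
  simp [hF, add_comm]

theorem length_relatorsA {G : Type*} [Group G] (g : ALetter → G) : (relatorsA g).length = 20 := rfl

theorem length_aLetters : aLetters.length = 9 := rfl

theorem length_sixWords {r : ℕ} : (sixWords (r := r)).length = 6 := rfl

theorem length_flatMap_aLetters {α : Type*} {n : ℕ} (f : ALetter → List α)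
    (hf : ∀ x, (f x).length = n) : (aLetters.flatMap f).length = 9 * n := by
  rw [List.length_flatMap, funext hf, List.map_const', List.sum_replicate, length_aLetters,
    smul_eq_mul]

theorem length_relatorsRho {r : ℕ} (R S : List (FreeGroup (FLetter ⊕ Fin r))) :
    (relatorsRho R S).length = R.length + 9 * r + S.length + 163 := by
  simp only [relatorsRho, List.length_append, List.length_map, List.length_cons, List.length_nil,
    length_relatorsA, length_aLetters, length_sixWords]
  rw [length_flatMap_aLetters (n := 9) _ fun x => by rw [List.length_map, length_aLetters],
    length_flatMap_aLetters (n := r) _ fun x => by rw [List.length_map, List.length_finRange]]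
  ring

theorem length_generatorsRho (r : ℕ) : (generatorsRho (r := r)).length = 6 := by
  rw [generatorsRho, List.length_map, length_sixWords]

/-! ### Change of generators -/

/-- Homomorphisms in both directions that match `F` and the generators of `L` are enough; they need
not be shown to be mutually inverse. -/
theorem isExplicitPair_adjoin {m : ℕ} (R S : List (FreeGroup (Fin m)))
    (w : FLetter → FreeGroup (Fin m)) (H : Subgroup F) (h : IsExplicitPair R S w H) :
    IsExplicitPair (adjoinRelators R w) (adjoinWords S) (fun x => FreeGroup.of (Sum.inl x)) H := by
  let mk := PresentedGroup.mk {y | y ∈ R}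
  let mk' := PresentedGroup.mk {y | y ∈ adjoinRelators R w}
  have hmk : ∀ y ∈ R, mk y = 1 := fun y hy => PresentedGroup.one_of_mem hy
  have hmk' : ∀ y ∈ adjoinRelators R w, mk' y = 1 := fun y hy => PresentedGroup.one_of_mem hy
  simp only [adjoinRelators, List.forall_mem_append, List.forall_mem_map] at hmk'
  let f : FreeGroup (FLetter ⊕ Fin m) →* FreeGroup (Fin m) :=
    FreeGroup.lift (Sum.elim w FreeGroup.of)
  have hf : ∀ y, f (FreeGroup.map Sum.inr y) = y := by
    intro y
    have : f.comp (FreeGroup.map Sum.inr) = MonoidHom.id _ := by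
      ext i
      simp [f]
    exact DFunLike.congr_fun this y
  obtain ⟨θ, hθ⟩ := exists_presentedHom (mk'.comp (FreeGroup.map Sum.inr)) hmk'.1
  obtain ⟨η, hη⟩ := exists_presentedHom (R := adjoinRelators R w) (mk.comp f) (by
    simp only [adjoinRelators, List.forall_mem_append, List.forall_mem_map, map_eqn, eqn_eq_one,
      MonoidHom.comp_apply, hf]
    exact ⟨hmk, fun x _ => by simp [f]⟩)
  have hηF : ∀ z, η (letterHom _ (fun x => FreeGroup.of (Sum.inl x)) z) = letterHom R w z := by
    intro z
    have : η.comp (letterHom _ fun x => FreeGroup.of (Sum.inl x)) = letterHom R w := by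
      ext x : 1
      simp only [MonoidHom.comp_apply, letterHom, FreeGroup.lift_apply_of, hη]
      simp [f, mk]
    exact DFunLike.congr_fun this z
  have hθF : ∀ z, θ (letterHom R w z) = letterHom _ (fun x => FreeGroup.of (Sum.inl x)) z := by
    intro z
    have : θ.comp (letterHom R w) =
        letterHom (adjoinRelators R w) fun x => FreeGroup.of (Sum.inl x) := by
      ext x : 1
      simp only [MonoidHom.comp_apply, letterHom, FreeGroup.lift_apply_of, hθ]
      exact (eqn_eq_one.1 ((map_eqn mk' _ _).symm.trans (hmk'.2 x (mem_fLetters x)))).symm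
    exact DFunLike.congr_fun this z
  refine ⟨fun y z hyz => h.1 ?_, ?_⟩
  · rw [← hηF, ← hηF, hyz]
  · rw [← h.2]
    ext z
    rw [Subgroup.mem_comap, Subgroup.mem_comap]
    constructor
    · intro hz
      have := Subgroup.mem_map_of_mem η hz
      rw [hηF, wordSubgroup, MonoidHom.map_closure] at this
      refine Subgroup.closure_mono ?_ this
      rintro _ ⟨_, ⟨s, hs, rfl⟩, rfl⟩
      obtain ⟨s, hs', rfl⟩ := List.mem_map.1 hs
      exact ⟨s, hs', by rw [hη, MonoidHom.comp_apply, hf]⟩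
    · intro hz
      have := Subgroup.mem_map_of_mem θ hz
      rw [hθF, wordSubgroup, MonoidHom.map_closure] at this
      refine Subgroup.closure_mono ?_ this
      rintro _ ⟨_, ⟨s, hs, rfl⟩, rfl⟩
      exact ⟨_, List.mem_map_of_mem hs, hθ s⟩

/-! ### Benign subgroups and explicit pairs -/

theorem IsExplicitPair.isBenign {β : Type} [Finite β] {R S : List (FreeGroup β)}
    {w : FLetter → FreeGroup β} {H : Subgroup F} (h : IsExplicitPair R S w H) : IsBenign H := by
  have : Finite {y | y ∈ R} := (List.finite_toSet R).to_subtype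
  refine ⟨Presented R, inferInstance, letterHom R w, wordSubgroup R S, ?_, ?_, h.1, h.2⟩
  · infer_instance
  · rw [Subgroup.fg_iff]
    refine ⟨_, rfl, ?_⟩
    refine ((List.finite_toSet S).image (PresentedGroup.mk {y | y ∈ R})).subset ?_
    rintro _ ⟨s, hs, rfl⟩
    exact ⟨s, hs, rfl⟩

/-- Finite presentability gives a presentation on finitely many letters; the images of `a, b, c` and
the generators of `L` are then written as words in these. -/
theorem IsBenign.exists_isExplicitPair {H : Subgroup F} (h : IsBenign H) :
    ∃ (m : ℕ) (R S : List (FreeGroup (Fin m))) (w : FLetter → FreeGroup (Fin m)),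
      IsExplicitPair R S w H := by
  obtain ⟨K, _, φ, L, hK, hL, hφ, hH⟩ := h
  obtain ⟨m, s, hs, ⟨e⟩⟩ := Group.IsFinitelyPresented.exists_mulEquiv_presentedGroup (G := K)
  obtain ⟨R, rfl⟩ : ∃ R : List (FreeGroup (Fin m)), {y | y ∈ R} = s :=
    ⟨hs.toFinset.toList, by ext; simp⟩
  obtain ⟨T, hT⟩ := hL
  choose c hc using fun x : K => PresentedGroup.mk_surjective {y | y ∈ R} (e x)
  have hlet : ∀ z, letterHom R (fun x => c (φ (FreeGroup.of x))) z = e (φ z) := by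
    intro z
    have : letterHom R (fun x => c (φ (FreeGroup.of x))) = e.toMonoidHom.comp φ := by
      ext x : 1
      simp [letterHom, hc]
    exact DFunLike.congr_fun this z
  have hword : wordSubgroup R (T.toList.map c) = L.map e.toMonoidHom := by
    rw [wordSubgroup, ← hT, MonoidHom.map_closure]
    congr 1
    ext y
    constructor
    · rintro ⟨s, hs, rfl⟩
      obtain ⟨x, hx, rfl⟩ := List.mem_map.1 hs
      exact ⟨x, by simpa using hx, (hc x).symm⟩
    · rintro ⟨x, hx, rfl⟩
      exact ⟨c x, List.mem_map_of_mem (by simpa using hx), (hc x).symm⟩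
  refine ⟨m, R, T.toList.map c, fun x => c (φ (FreeGroup.of x)), fun y z hyz => ?_, ?_⟩
  · rw [hlet, hlet] at hyz
    exact hφ (e.injective hyz)
  · rw [← hH]
    ext z
    rw [Subgroup.mem_comap, Subgroup.mem_comap, hlet, hword]
    exact Subgroup.mem_map_iff_mem (f := e.toMonoidHom) e.injective

end Higman

theorem theorem1p1 (X : Set Higman.E) :
    -- if `A_X` is benign in `F`, then so is `A_{ρX}`
    (Higman.IsBenign (Higman.subgroupA X) → Higman.IsBenign (Higman.subgroupA (Higman.rho X))) ∧
    -- explicit groups for `X`, with `a, b, c` among the generators, give explicit ones for `ρX`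
    (∀ (r : ℕ) (R S : List (FreeGroup (Higman.FLetter ⊕ Fin r))),
      Higman.IsExplicitPair R S (fun x => FreeGroup.of (Sum.inl x)) (Higman.subgroupA X) →
      Higman.IsExplicitPair (Higman.relatorsRho R S) Higman.generatorsRho Higman.lettersRho
        (Higman.subgroupA (Higman.rho X))) ∧
    -- the numbers of generators and of relations, and of generators of the subgroup
    (∀ (r m n k : ℕ) (R S : List (FreeGroup (Higman.FLetter ⊕ Fin r))),
      m = Nat.card (Higman.FLetter ⊕ Fin r) → n = R.length → k = S.length →
      Nat.card (Higman.KLetter r) = m + 21 ∧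
      (Higman.relatorsRho R S).length = n + 9 * m + k + 136 ∧
      (Higman.generatorsRho (r := r)).length = 6) ∧
    -- explicit groups for `X` over arbitrary generators give explicit ones for `ρX`
    (∀ (m : ℕ) (R S : List (FreeGroup (Fin m))) (w : Higman.FLetter → FreeGroup (Fin m)),
      Higman.IsExplicitPair R S w (Higman.subgroupA X) →
      Higman.IsExplicitPair
        (Higman.relatorsRho (Higman.adjoinRelators R w) (Higman.adjoinWords S))
        Higman.generatorsRho Higman.lettersRho (Higman.subgroupA (Higman.rho X))) := by
  have h4 : ∀ (m : ℕ) (R S : List (FreeGroup (Fin m))) (w : Higman.FLetter → FreeGroup (Fin m)),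
      Higman.IsExplicitPair R S w (Higman.subgroupA X) →
      Higman.IsExplicitPair
        (Higman.relatorsRho (Higman.adjoinRelators R w) (Higman.adjoinWords S))
        Higman.generatorsRho Higman.lettersRho (Higman.subgroupA (Higman.rho X)) :=
    fun m R S w h => Higman.isExplicitPair_rho _ _ X (Higman.isExplicitPair_adjoin R S w _ h)
  refine ⟨fun h => ?_, fun r R S h => Higman.isExplicitPair_rho R S X h, ?_, h4⟩
  · obtain ⟨m, R, S, w, h⟩ := h.exists_isExplicitPair
    exact (h4 m R S w h).isBenign
  · rintro r m n k R S rfl rfl rfl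
    rw [Higman.card_kLetter, Higman.card_generators, Higman.length_relatorsRho]
    exact ⟨by ring, by ring, Higman.length_generatorsRho r⟩
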